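/- Let $G$ be a finite solvable group and let $H$ be a subgroup of $\operatorname{Aut}(G)$. Suppose that there exists an $H$-invariant Carter subgroup $F$ of $G$ (that is, a nilpotent subgroup with $N_G(F)=F$) such that the semidirect product $FH$ is a Frobenius group with kernel $F$ and complement $H$. Let $C_G(H)$ denote the subgroup of all elements of $G$ that are fixed by every element of $H$. Then: (a) $O_\pi(C_G(H)) = O_\pi(G)\cap C_G(H)$ for every set of primes $\pi$; (b) $O_{\pi_1,\pi_2,\dots,\pi_k}(C_G(H)) = O_{\pi_1,\pi_2,\dots,\pi_k}(G)\cap C_G(H)$ for all sets of primes $\pi_1,\pi_2,\dots,\pi_k$; (c) $\ell_\pi(G)\le \ell_\pi(C_G(H))+1$ for every set of primes $\pi$. Here, for a finite group $X$, $O_\pi(X)$ is the largest normal $\pi$-subgroup of $X$, and the terms $O_{\pi_1,\dots,\pi_k}(X)$ are defined by taking the trivial subgroup for $k=0$ and, for $k\ge 1$, letting $O_{\pi_1,\dots,\pi_k}(X)$ be the full preimage in $X$ of $O_{\pi_k}\bigl(X/O_{\pi_1,\dots,\pi_{k-1}}(X)\bigr)$. For a finite solvable group $X$, the $\pi$-length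 $\ell_\pi(X)$ is the least $m\ge 0$ such that $O_{\pi',\pi,\pi',\dots,\pi,\pi'}(X)=X$, where $\pi$ occurs $m$ times and $\pi'$ is the set of primes not in $\pi$. -/

import Mathlib

namespace FrobCarter

/-- A Carter subgroup: a nilpotent, self-normalizing subgroup. -/
structure IsCarter {G : Type*} [Group G] (F : Subgroup G) : Prop where
  nilpotent : Group.IsNilpotent F
  self_normalizing : Subgroup.normalizer (F : Set G) = F

/-- `F` is invariant under every automorphism belonging to `H`. -/
def IsInvariant {G : Type*} [Group G] (H : Subgroup (MulAut G)) (F : Subgroup G) : Prop :=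
  ∀ h ∈ H, ∀ x ∈ F, h x ∈ F

/-- The action of `H` on an `H`-invariant subgroup `F`, by restriction. -/
def restrictAction {G : Type*} [Group G] (H : Subgroup (MulAut G)) (F : Subgroup G)
    (hF : IsInvariant H F) : H →* MulAut F where
  toFun h :=
    { toFun := fun x => ⟨(h : MulAut G) x, hF h h.2 x x.2⟩
      invFun := fun x => ⟨(h : MulAut G)⁻¹ x, hF _ (H.inv_mem h.2) x x.2⟩
      left_inv := fun x => Subtype.ext (MulAut.inv_apply_self G (h : MulAut G) (x : G))
      right_inv := fun x => Subtype.ext (MulAut.apply_inv_self G (h : MulAut G) (x : G))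
      map_mul' := fun x y => Subtype.ext (map_mul (h : MulAut G) (x : G) (y : G)) }
  map_one' := rfl
  map_mul' _ _ := rfl

/-- `X` is a Frobenius group with kernel `K` and complement `A`: `X` is the (internal) semidirect
product of a nontrivial normal subgroup `K` and a nontrivial subgroup `A`, and no nonidentity
element of `A` commutes with a nonidentity element of `K`. -/
structure IsFrobenius {X : Type*} [Group X] (K A : Subgroup X) : Prop where
  normal : K.Normal
  compl : Subgroup.IsComplement' K A
  kernel_ne_bot : K ≠ ⊥
  complement_ne_bot : A ≠ ⊥
  fixed_point_free : ∀ a ∈ A, a ≠ 1 → ∀ k ∈ K, k ≠ 1 → a * k ≠ k * a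

/-- The semidirect product `FH` of an `H`-invariant subgroup `F` by `H` is a Frobenius group with
kernel `F` and complement `H`. -/
def ActsFrobeniusly {G : Type*} [Group G] (H : Subgroup (MulAut G)) (F : Subgroup G)
    (hF : IsInvariant H F) : Prop :=
  IsFrobenius (X := F ⋊[restrictAction H F hF] H)
    (SemidirectProduct.inl : F →* F ⋊[restrictAction H F hF] H).range
    (SemidirectProduct.inr : H →* F ⋊[restrictAction H F hF] H).range

/-- For a finite group: every prime divisor of the order lies in `π`. -/
def IsPiGroup (π : Set Nat.Primes) (G : Type*) [Group G] : Prop :=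
  ∀ p : Nat.Primes, (p : ℕ) ∣ Nat.card G → p ∈ π

/-- `O_π(G)`, the subgroup generated by all normal `π`-subgroups of `G` (for finite `G`, the
largest normal `π`-subgroup). -/
def piCore (π : Set Nat.Primes) (G : Type*) [Group G] : Subgroup G :=
  sSup {N : Subgroup G | N.Normal ∧ IsPiGroup π N}

theorem piCore_normal (π : Set Nat.Primes) (G : Type*) [Group G] : (piCore π G).Normal :=
  Subgroup.sSup_normal _ fun _ hN => hN.1

/-- The full preimage in `G` of `O_π(G/N)`, for a normal subgroup `N` of `G`. -/
def piStep {G : Type*} [Group G] (N : {N : Subgroup G // N.Normal}) (π : Set Nat.Primes) :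
    {N : Subgroup G // N.Normal} :=
  haveI : N.1.Normal := N.2
  ⟨(piCore π (G ⧸ N.1)).comap (QuotientGroup.mk' N.1), (piCore_normal π (G ⧸ N.1)).comap _⟩

/-- `piSeries [π₁, …, πₖ] G` is `O_{π₁,…,πₖ}(G)`: the trivial subgroup for `k = 0`, and
`O_{π₁,…,πₖ}(G) / O_{π₁,…,πₖ₋₁}(G) = O_{πₖ}(G / O_{π₁,…,πₖ₋₁}(G))`. -/
def piSeries (πs : List (Set Nat.Primes)) (G : Type*) [Group G] : Subgroup G :=
  (πs.foldl piStep ⟨(⊥ : Subgroup G), inferInstance⟩).1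

/-- The list `[π', π, π', …, π, π']` in which `π` occurs `m` times. -/
def alternating (π : Set Nat.Primes) (m : ℕ) : List (Set Nat.Primes) :=
  πᶜ :: (List.replicate m [π, πᶜ]).flatten

/-- The `π`-length: the least `m` with `O_{π',π,π',…,π,π'}(G) = G`, where `π` occurs `m` times
(and `⊤` if there is none, that is, if `G` is not `π`-separable). -/
noncomputable def piLength (π : Set Nat.Primes) (G : Type*) [Group G] : ℕ∞ :=
  ⨅ (m : ℕ) (_ : piSeries (alternating π m) G = ⊤), (m : ℕ∞)

/-- `C_G(H)`, the subgroup of the elements of `G` fixed by every automorphism in `H`. -/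
abbrev fixedSubgroup {G : Type*} [Group G] (H : Subgroup (MulAut G)) : Subgroup G :=
  FixedPoints.subgroup H G

end FrobCarter

/-! Write `C` for the fixed points of the acting group `S`. Only two properties of `F` are used: it
is a Carter subgroup, and each nonidentity element of `S` acts on it without nontrivial fixed
points. Both pass to quotients by invariant normal subgroups (`IsCarter.normalizer_sup`,
`FrobeniusCarter.quotient`), so one can induct along an elementary abelian normal subgroup `A`.

Three facts carry the proof. Fixed points lift from quotients
(`FrobeniusCarter.exists_mul_mem_fixedBy`), although the order of `S` need not be prime to that of
`G`: as `F \ {1}` is a union of regular `S`-orbits, a cocycle with values in `A` is cohomologous to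
its norm over `F`, which lies in `F ⊓ A`, where coprimality holds. Next, if `C = 1` then `G = F` is
nilpotent (`FrobeniusCarter.eq_top_of_fixedBy_eq_bot`), by comparing norms over conjugates of `S`.

The third and hardest fact is that a normal `q`-subgroup `Q` of `C` lies in `O_q(G)`
(`FrobeniusCarter.le_piCore_singleton`). Inductively, `Q` lies in the preimage `M` of `O_q(G/A)`,
and for `p ≠ q` one must show that `Q` centralizes the `p`-group `A`. Norms over `S` of elements of
`A` lie in `C`, and `Q` centralizes them because `Q ⊓ A = 1`. After dualizing to a vector space in
characteristic `p`, `Q` acts trivially on all weight spaces of the centre of `M` whose weight has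
trivial stabilizer in `S`. An `F`-orbit contains at most one other weight. If something in the
centre detected it, a product of `F`-conjugates would be constant and nontrivial along the orbit,
hence centralized by `F` and by some `s ≠ 1` in a section of `M`. The Carter property puts such an
element in the image of `F`, where `s` has no fixed points.

The statements for sets of primes and for series follow by passing to quotients. For the length,
once a term of the series contains `C`, the quotient by it has no fixed points, so it is nilpotent
and one more `π`-step suffices. -/

namespace FrobCarter

/-! ### Semiregular actions and nonregular points of orbits -/

/-- A finite group acting on a finite set such that every nonidentity element has exactly one
fixed point has a common fixed point. -/
theorem exists_common_fixedPoint {S X : Type*} [Group S] [Finite S] [Nontrivial S] [Finite X]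
    [MulAction S X] (h : ∀ s : S, s ≠ 1 → ∃! x : X, s • x = x) :
    ∃ x : X, ∀ s : S, s • x = x := by
  classical
  cases nonempty_fintype S
  cases nonempty_fintype X
  by_contra! hno
  have hS : 2 ≤ Fintype.card S := Fintype.one_lt_card
  have hburn := MulAction.sum_card_fixedBy_eq_card_orbits_mul_card_group S X
  have hfix : ∀ s : S, s ≠ 1 → Fintype.card (MulAction.fixedBy X s) = 1 := by
    intro s hs
    obtain ⟨x, hx, hu⟩ := h s hs
    exact Fintype.card_eq_one_iff.2 ⟨⟨x, hx⟩, fun y => Subtype.ext (hu _ y.2)⟩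
  have h1 : Fintype.card (MulAction.fixedBy X (1 : S)) = Fintype.card X :=
    Fintype.card_congr ((Equiv.setCongr (by ext; simp)).trans (Equiv.Set.univ X))
  rw [← Finset.add_sum_erase _ _ (Finset.mem_univ (1 : S)), h1,
    Finset.sum_congr rfl fun s hs => hfix s (Finset.ne_of_mem_erase hs)] at hburn
  simp only [Finset.sum_const, smul_eq_mul, mul_one, Finset.card_erase_of_mem (Finset.mem_univ _),
    Finset.card_univ] at hburn
  have hX : Fintype.card X = ∑ ω : MulAction.orbitRel.Quotient S X, Fintype.card ω.orbit := by
    rw [← Fintype.card_sigma]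
    exact Fintype.card_congr (MulAction.selfEquivSigmaOrbits' S X)
  have hdiv : ∀ ω : MulAction.orbitRel.Quotient S X,
      Fintype.card ω.orbit ∣ Fintype.card S ∧ 2 ≤ Fintype.card ω.orbit := by
    intro ω
    induction ω using Quotient.inductionOn' with | _ x
    have e : MulAction.orbitRel.Quotient.orbit (Quotient.mk'' x : MulAction.orbitRel.Quotient S X) =
        MulAction.orbit S x :=
      MulAction.orbitRel.Quotient.orbit_mk x
    have e' := Fintype.card_congr (Equiv.setCongr e)
    rw [e']
    refine ⟨⟨_, (MulAction.card_orbit_mul_card_stabilizer_eq_card_group S x).symm⟩, ?_⟩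
    obtain ⟨s, hs⟩ := hno x
    exact Fintype.one_lt_card_iff.2 ⟨⟨s • x, ⟨s, rfl⟩⟩, ⟨x, MulAction.mem_orbit_self x⟩,
      fun h => hs (congrArg Subtype.val h)⟩
  set n := Fintype.card S with hn
  set c : MulAction.orbitRel.Quotient S X → ℕ := fun ω => Fintype.card ω.orbit with hc
  -- Burnside's count reads `|X| + (n - 1) = n * #orbits`; it fixes the total deficit of the orbits.
  have hsum : (∑ ω, ((n : ℤ) - c ω)) = n - 1 := by
    rw [Finset.sum_sub_distrib, Finset.sum_const, Finset.card_univ]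
    have : (Fintype.card X : ℤ) = ∑ ω, (c ω : ℤ) := by exact_mod_cast hX
    rw [← this]
    zify [show 1 ≤ n by omega] at hburn
    simp only [nsmul_eq_mul]
    linarith
  have hf : ∀ ω, (n : ℤ) - c ω = 0 ∨ (n : ℤ) ≤ 2 * (n - c ω) := by
    intro ω
    obtain ⟨⟨d, hd⟩, h2⟩ := hdiv ω
    rcases Nat.lt_or_ge d 2 with h | h
    · interval_cases d
      · omega
      · left; change n = c ω * 1 at hd; omega
    · right
      change n = c ω * d at hd
      have : c ω * 2 ≤ n := hd ▸ Nat.mul_le_mul_left _ h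
      omega
  have hpos : ∀ ω, 0 ≤ (n : ℤ) - c ω := fun ω => by have := hf ω; omega
  -- Orbits have at least two points, so one deficit is at most `n - 2` and a second must be
  -- positive. Two positive deficits, each at least `n / 2`, exceed the total `n - 1`.
  have hne : (∑ ω, ((n : ℤ) - c ω)) ≠ 0 := by omega
  obtain ⟨ω₁, -, h1⟩ := Finset.exists_ne_zero_of_sum_ne_zero hne
  have hsplit := Finset.add_sum_erase Finset.univ (fun ω => (n : ℤ) - c ω) (Finset.mem_univ ω₁)
  have h2 : 2 ≤ c ω₁ := (hdiv ω₁).2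
  have hne2 : (∑ ω ∈ Finset.univ.erase ω₁, ((n : ℤ) - c ω)) ≠ 0 := by
    omega
  obtain ⟨ω₂, hm, h3⟩ := Finset.exists_ne_zero_of_sum_ne_zero hne2
  have h4 := Finset.single_le_sum (f := fun ω => (n : ℤ) - c ω) (fun ω _ => hpos ω) hm
  have h5 := hf ω₁
  have h6 := hf ω₂
  omega

/-- Semiregularity of conjugation makes `f ↦ [f, h]` injective. -/
theorem eq_of_twisted_eq {Γ : Type*} [Group Γ] {F : Subgroup Γ} {h : Γ}
    (hfpf : ∀ f ∈ F, h * f = f * h → f = 1) {f g : Γ} (hf : f ∈ F) (hg : g ∈ F)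
    (e : f⁻¹ * (h * f * h⁻¹) = g⁻¹ * (h * g * h⁻¹)) : f = g := by
  have := hfpf (g * f⁻¹) (F.mul_mem hg (F.inv_mem hf)) (by
    have e2 : f⁻¹ * h * f = g⁻¹ * h * g := by
      have := congrArg (· * h) e
      simpa [mul_assoc] using this
    calc h * (g * f⁻¹) = g * (g⁻¹ * h * g) * f⁻¹ := by group
      _ = g * f⁻¹ * h := by rw [← e2]; group)
  exact (mul_inv_eq_one.1 this).symm

/-- An injective self-map of the finite set `F` is onto. -/
theorem exists_twisted_eq {Γ : Type*} [Group Γ] [Finite Γ] {F : Subgroup Γ} {h : Γ}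
    (hF : ∀ f ∈ F, h * f * h⁻¹ ∈ F) (hfpf : ∀ f ∈ F, h * f = f * h → f = 1) {k : Γ} (hk : k ∈ F) :
    ∃ f ∈ F, f⁻¹ * (h * f * h⁻¹) = k := by
  let t : F → F := fun f => ⟨(f : Γ)⁻¹ * (h * f * h⁻¹), F.mul_mem (F.inv_mem f.2) (hF _ f.2)⟩
  have ht : Function.Injective t := fun f g e =>
    Subtype.ext (eq_of_twisted_eq hfpf f.2 g.2 (congrArg Subtype.val e))
  obtain ⟨f, hf⟩ := (Finite.injective_iff_surjective.1 ht) ⟨k, hk⟩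
  exact ⟨f, f.2, congrArg Subtype.val hf⟩

/-- The commutator of `f` and `h` stabilizes `χ`. The twisted map is already onto on the
`h`-invariant stabilizer of `χ` in `F`, so its injectivity on `F` puts `f` in that stabilizer. -/
theorem fixedPoint_unique_of_orbit {Γ X : Type*} [Group Γ] [Finite Γ] [MulAction Γ X]
    {F : Subgroup Γ} {h : Γ} (hF : ∀ f ∈ F, h * f * h⁻¹ ∈ F)
    (hfpf : ∀ f ∈ F, h * f = f * h → f = 1) {χ : X} (hχ : h • χ = χ) {f : Γ} (hf : f ∈ F)
    (hfχ : h • f • χ = f • χ) : f • χ = χ := by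
  have hst : f⁻¹ * (h * f * h⁻¹) ∈ F ⊓ MulAction.stabilizer Γ χ := by
    refine ⟨F.mul_mem (F.inv_mem hf) (hF _ hf), ?_⟩
    have : h⁻¹ • χ = χ := by rw [inv_smul_eq_iff, hχ]
    change (f⁻¹ * (h * f * h⁻¹)) • χ = χ
    simp only [mul_smul, this, hfχ, inv_smul_smul]
  obtain ⟨g, hg, e⟩ := exists_twisted_eq (F := F ⊓ MulAction.stabilizer Γ χ) (h := h) (by
    rintro g ⟨hg, hs⟩
    refine ⟨hF _ hg, ?_⟩
    have : h⁻¹ • χ = χ := by rw [inv_smul_eq_iff, hχ]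
    replace hs : g • χ = χ := hs
    change (h * g * h⁻¹) • χ = χ
    simp only [mul_smul, this, hs, hχ]) (fun f hf => hfpf f hf.1) hst
  have := eq_of_twisted_eq hfpf hg.1 hf e
  exact this ▸ hg.2

open scoped Pointwise in
/-- Let `H` act semiregularly on `F`. In an `F`-orbit there is at most one point having a
nontrivial stabilizer in `H`. -/
theorem eq_of_nonregular {Γ X : Type*} [Group Γ] [Finite Γ] [MulAction Γ X] {F H : Subgroup Γ}
    (hF : ∀ h ∈ H, ∀ f ∈ F, h * f * h⁻¹ ∈ F)
    (hfpf : ∀ h ∈ H, h ≠ 1 → ∀ f ∈ F, h * f = f * h → f = 1)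
    {χ : X} {f h h' : Γ} (hf : f ∈ F) (hh : h ∈ H) (h1 : h ≠ 1) (hχ : h • χ = χ)
    (hh' : h' ∈ H) (h1' : h' ≠ 1) (hfχ : h' • f • χ = f • χ) : f • χ = χ := by
  classical
  set O : Set X := MulAction.orbit F χ with hO
  have hOeq : ∀ x ∈ O, MulAction.orbit F x = O := fun x hx => MulAction.orbit_eq_iff.2 hx
  -- Since `H` normalizes `F`, it permutes the `F`-orbits; meeting `O` in one point is enough to
  -- preserve it.
  have key : ∀ s ∈ H, ∀ x ∈ O, s • x ∈ O → s ∈ MulAction.stabilizer Γ O := by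
    intro s hs x hx hsx
    have hsub : ∀ y ∈ O, s • y ∈ O := by
      intro y hy
      rw [← hOeq x hx] at hy
      obtain ⟨g, rfl⟩ := hy
      rw [← hOeq _ hsx]
      refine ⟨⟨s * g * s⁻¹, hF s hs g g.2⟩, ?_⟩
      change (s * g * s⁻¹) • s • x = s • (g : Γ) • x
      simp only [mul_smul, inv_smul_smul]
    have hfin : O.Finite := (Set.finite_range _)
    rw [MulAction.mem_stabilizer_iff]
    exact Set.eq_of_subset_of_ncard_le (by rintro _ ⟨y, hy, rfl⟩; exact hsub y hy)
      (by rw [Set.ncard_smul_set]) hfin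
  let S : Subgroup Γ := H ⊓ MulAction.stabilizer Γ O
  let _ : MulAction S O := MulAction.compHom O (Subgroup.inclusion (inf_le_right : S ≤ _))
  have hsm : ∀ (s : S) (x : O), ((s • x : O) : X) = (s : Γ) • (x : X) := fun _ _ => rfl
  have hχO : χ ∈ O := MulAction.mem_orbit_self χ
  have hfO : f • χ ∈ O := ⟨⟨f, hf⟩, rfl⟩
  have hS : h ∈ S := ⟨hh, key h hh χ hχO (by rwa [hχ])⟩
  have hS' : h' ∈ S := ⟨hh', key h' hh' _ hfO (by rwa [hfχ])⟩
  have : Nontrivial S := ⟨⟨⟨h, hS⟩, 1, fun e => h1 (congrArg Subtype.val e)⟩⟩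
  have huniq : ∀ s ∈ H, s ≠ 1 → ∀ x ∈ O, ∀ y ∈ O, s • x = x → s • y = y → x = y := by
    intro s hs hs1 x hx y hy ex ey
    rw [← hOeq x hx] at hy
    obtain ⟨g, rfl⟩ := hy
    exact (fixedPoint_unique_of_orbit (hF s hs) (hfpf s hs hs1) ex g.2 ey).symm
  have : Finite O := Set.Finite.to_subtype (Set.finite_range _)
  obtain ⟨x, hx⟩ := exists_common_fixedPoint (S := S) (X := O) (by
    rintro ⟨s, hsH, hsO⟩ hs1
    have hs1 : s ≠ 1 := fun e => hs1 (Subtype.ext e)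
    have hsχ : s • χ ∈ O := by
      have : s • χ ∈ s • O := ⟨χ, hχO, rfl⟩
      rwa [MulAction.mem_stabilizer_iff.1 hsO] at this
    obtain ⟨g, hg⟩ := hsχ
    -- With `s • χ = g • χ`, the choice of `u` cancels `g`, so that `s` fixes `u • χ`.
    obtain ⟨u, hu, e⟩ := exists_twisted_eq (hF s hsH) (hfpf s hsH hs1) (F.inv_mem g.2)
    have e2 : s * u = u * (g : Γ)⁻¹ * s := by rw [← e]; group
    have hfix : s • u • χ = u • χ := by
      rw [← mul_smul, e2, mul_smul, mul_smul, ← hg]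
      change u • (g : Γ)⁻¹ • (g : Γ) • χ = _
      rw [inv_smul_smul]
    exact ⟨⟨u • χ, ⟨u, hu⟩, rfl⟩, Subtype.ext hfix, fun y hy =>
      Subtype.ext (huniq s hsH hs1 _ y.2 _ ⟨⟨u, hu⟩, rfl⟩ (congrArg Subtype.val hy) hfix)⟩)
  have ex : ∀ s (hs : s ∈ S), s • (x : X) = x := fun s hs => congrArg Subtype.val (hx ⟨s, hs⟩)
  rw [huniq h' hh' h1' _ hfO _ x.2 hfχ (ex h' hS'), huniq h hh h1 _ hχO _ x.2 hχ (ex h hS)]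

/-! ### Weight spaces of the centre of a linear `q`-group -/

/-- A nontrivial normal subgroup of a finite `q`-group meets the centre nontrivially. -/
theorem exists_mem_center_of_normal {Q : Type*} [Group Q] [Finite Q] {q : ℕ} [Fact q.Prime]
    (hQ : IsPGroup q Q) (N : Subgroup Q) [N.Normal] {x : Q} (hx : x ∈ N) (hx1 : x ≠ 1) :
    ∃ z ∈ N, z ≠ 1 ∧ ∀ m, m * z = z * m := by
  let _ : MulAction Q N := MulAction.compHom N (MulAut.conjNormal : Q →* MulAut N)
  have hsm : ∀ (g : Q) (n : N), ((g • n : N) : Q) = g * n * g⁻¹ := fun g n =>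
    MulAut.conjNormal_apply g n
  have hdvd : q ∣ Nat.card N := by
    have : q ∣ orderOf (⟨x, hx⟩ : N) :=
      (hQ.to_subgroup N).dvd_orderOf fun e => hx1 (congrArg Subtype.val e)
    exact this.trans (orderOf_dvd_natCard _)
  have h1 : (1 : N) ∈ MulAction.fixedPoints Q N := fun g => Subtype.ext (by simp [hsm])
  obtain ⟨z, hz, hne⟩ := hQ.exists_fixed_point_of_prime_dvd_card_of_fixed_point N hdvd h1
  refine ⟨z, z.2, fun e => hne (Subtype.ext e.symm), fun m => ?_⟩
  have := congrArg Subtype.val (hz m)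
  rw [hsm] at this
  exact mul_inv_eq_iff_eq_mul.1 this

section Weights

variable {ι k V : Type*} [Field k] [AddCommGroup V] [Module k V]

/-- The simultaneous eigenspace of a family of endomorphisms. -/
def weightSpace (f : ι → Module.End k V) (χ : ι → k) : Submodule k V :=
  ⨅ i, (f i).eigenspace (χ i)

theorem mem_weightSpace {f : ι → Module.End k V} {χ : ι → k} {v : V} :
    v ∈ weightSpace f χ ↔ ∀ i, f i v = χ i • v := by
  simp [weightSpace, Submodule.mem_iInf]

theorem weightSpace_eq {f : ι → Module.End k V} (hs : ∀ i, (f i).IsFinitelySemisimple) :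
    weightSpace f = fun χ => ⨅ i, (f i).maxGenEigenspace (χ i) := by
  funext χ
  unfold weightSpace
  congr 1
  funext i
  rw [(hs i).maxGenEigenspace_eq_eigenspace]

theorem iSupIndep_weightSpace {f : ι → Module.End k V} (hc : ∀ i j, Commute (f i) (f j))
    (hs : ∀ i, (f i).IsFinitelySemisimple) : iSupIndep (weightSpace f) := by
  rw [weightSpace_eq hs]
  exact Module.End.independent_iInf_maxGenEigenspace_of_forall_mapsTo f fun i j φ =>
    Module.End.mapsTo_maxGenEigenspace_of_comm (hc j i) φ

theorem iSup_weightSpace [FiniteDimensional k V] [IsAlgClosed k] {f : ι → Module.End k V}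
    (hc : ∀ i j, Commute (f i) (f j)) (hs : ∀ i, (f i).IsFinitelySemisimple) :
    ⨆ χ, weightSpace f χ = ⊤ := by
  rw [weightSpace_eq hs]
  exact Module.End.iSup_iInf_maxGenEigenspace_eq_top_of_iSup_maxGenEigenspace_eq_top_of_commute f
    (fun i j _ => hc i j) fun i => Module.End.iSup_maxGenEigenspace_eq_top (f i)

end Weights

/-- Functions on a group, on which the group acts by conjugating the argument. -/
def ConjFun (Γ k : Type*) := Γ → k

instance {Γ k : Type*} [Group Γ] : MulAction Γ (ConjFun Γ k) where
  smul g χ := fun a => χ (g⁻¹ * a * g)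
  one_smul χ := by funext a; change χ (1⁻¹ * a * 1) = χ a; simp
  mul_smul g g' χ := by
    funext a
    change χ ((g * g')⁻¹ * a * (g * g')) = χ (g'⁻¹ * (g⁻¹ * a * g) * g')
    congr 1
    group

theorem ConjFun.smul_apply {Γ k : Type*} [Group Γ] (g : Γ) (χ : ConjFun Γ k) (a : Γ) :
    (g • χ) a = χ (g⁻¹ * a * g) := rfl

section

variable {Γ k V : Type*} [Group Γ] [Field k] [AddCommGroup V] [Module k V]
  (ρ : Γ →* Module.End k V) (M : Subgroup Γ)

/-- The elements of `M` acting centrally with respect to `M`. -/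
def centralPart : Subgroup Γ where
  carrier := {a | a ∈ M ∧ ∀ m ∈ M, ρ (a * m) = ρ (m * a)}
  one_mem' := ⟨M.one_mem, fun m _ => by simp⟩
  mul_mem' := by
    rintro a b ⟨ha, ha'⟩ ⟨hb, hb'⟩
    refine ⟨M.mul_mem ha hb, fun m hm => ?_⟩
    rw [mul_assoc, map_mul, hb' m hm, ← map_mul, ← mul_assoc, map_mul, ha' m hm, ← map_mul,
      mul_assoc]
  inv_mem' := by
    rintro a ⟨ha, ha'⟩
    refine ⟨M.inv_mem ha, fun m hm => ?_⟩
    have := ha' m hm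
    calc ρ (a⁻¹ * m) = ρ a⁻¹ * ρ (m * a) * ρ a⁻¹ := by
          rw [← map_mul, ← map_mul]; congr 1; group
      _ = ρ (m * a⁻¹) := by rw [← this, ← map_mul, ← map_mul]; congr 1; group

open Classical in
/-- The operators of the central part, extended by zero. -/
noncomputable def centralFamily (a : Γ) : Module.End k V :=
  if a ∈ centralPart ρ M then ρ a else 0

variable {ρ M}

theorem centralFamily_of_mem {a : Γ} (ha : a ∈ centralPart ρ M) : centralFamily ρ M a = ρ a :=
  if_pos ha

theorem conj_mem_centralPart {g a : Γ} (hg : g ∈ Subgroup.normalizer (M : Set Γ))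
    (ha : a ∈ centralPart ρ M) : g⁻¹ * a * g ∈ centralPart ρ M := by
  have hg' := Subgroup.mem_normalizer_iff.1 hg
  have hg'' := Subgroup.mem_normalizer_iff''.1 hg
  refine ⟨(hg'' a).1 ha.1, fun m hm => ?_⟩
  have := ha.2 _ ((hg' m).1 hm)
  calc ρ (g⁻¹ * a * g * m) = ρ g⁻¹ * ρ (a * (g * m * g⁻¹)) * ρ g := by
        rw [← map_mul, ← map_mul]; congr 1; group
    _ = ρ (m * (g⁻¹ * a * g)) := by rw [this, ← map_mul, ← map_mul]; congr 1; group

/-- The normalizer preserves `centralPart`, so the extension by zero makes the identity valid for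
every `a`. Thus the normalizer permutes the weight spaces. -/
theorem centralFamily_conj {g a : Γ} (hg : g ∈ Subgroup.normalizer (M : Set Γ)) :
    centralFamily ρ M a * ρ g = ρ g * centralFamily ρ M (g⁻¹ * a * g) := by
  by_cases ha : a ∈ centralPart ρ M
  · rw [centralFamily_of_mem ha, centralFamily_of_mem (conj_mem_centralPart hg ha), ← map_mul,
      ← map_mul]
    congr 1
    group
  · have : g⁻¹ * a * g ∉ centralPart ρ M := fun h => ha (by
      have := conj_mem_centralPart (Subgroup.inv_mem _ hg) h
      convert this using 1
      group)
    simp [centralFamily, ha, this]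

theorem centralFamily_comm (a b : Γ) :
    Commute (centralFamily ρ M a) (centralFamily ρ M b) := by
  by_cases ha : a ∈ centralPart ρ M
  · by_cases hb : b ∈ centralPart ρ M
    · rw [centralFamily_of_mem ha, centralFamily_of_mem hb]
      change _ * _ = _ * _
      rw [← map_mul, ← map_mul, ha.2 b hb.1]
    · simp [centralFamily, hb]
  · simp [centralFamily, ha]

variable (ρ M) in
/-- The weight spaces of the central part. -/
noncomputable def centralWeightSpace (χ : ConjFun Γ k) : Submodule k V :=
  weightSpace (centralFamily ρ M) χ

theorem apply_mem_centralWeightSpace {g : Γ} (hg : g ∈ Subgroup.normalizer (M : Set Γ))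
    {χ : ConjFun Γ k} {v : V} (hv : v ∈ centralWeightSpace ρ M χ) :
    ρ g v ∈ centralWeightSpace ρ M (g • χ) := by
  refine mem_weightSpace.2 fun a => ?_
  have h := mem_weightSpace.1 hv (g⁻¹ * a * g)
  rw [← Module.End.mul_apply, centralFamily_conj hg, Module.End.mul_apply, h, map_smul]
  rfl

theorem apply_mem_centralWeightSpace_of_mem {m : Γ} (hm : m ∈ M)
    {χ : ConjFun Γ k} {v : V} (hv : v ∈ centralWeightSpace ρ M χ) :
    ρ m v ∈ centralWeightSpace ρ M χ := by
  refine mem_weightSpace.2 fun a => ?_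
  have h := mem_weightSpace.1 hv a
  have : centralFamily ρ M a * ρ m = ρ m * centralFamily ρ M a := by
    by_cases ha : a ∈ centralPart ρ M
    · rw [centralFamily_of_mem ha, ← map_mul, ← map_mul, ha.2 m hm]
    · simp [centralFamily, ha]
  rw [← Module.End.mul_apply, this, Module.End.mul_apply, h, map_smul]

theorem apply_of_mem_centralWeightSpace {a : Γ} (ha : a ∈ centralPart ρ M)
    {χ : ConjFun Γ k} {v : V} (hv : v ∈ centralWeightSpace ρ M χ) : ρ a v = χ a • v := by
  have h := mem_weightSpace.1 hv a
  rwa [centralFamily_of_mem ha] at h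

theorem weight_mul {χ : ConjFun Γ k} {v : V} (hv : v ∈ centralWeightSpace ρ M χ) (hv0 : v ≠ 0)
    {a b : Γ} (ha : a ∈ centralPart ρ M) (hb : b ∈ centralPart ρ M) : χ (a * b) = χ a * χ b := by
  have h := apply_of_mem_centralWeightSpace ((centralPart ρ M).mul_mem ha hb) hv
  rw [map_mul, Module.End.mul_apply, apply_of_mem_centralWeightSpace hb hv, map_smul,
    apply_of_mem_centralWeightSpace ha hv, smul_smul] at h
  rw [← smul_left_injective k hv0 h, mul_comm]

theorem weight_one {χ : ConjFun Γ k} {v : V} (hv : v ∈ centralWeightSpace ρ M χ) (hv0 : v ≠ 0) :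
    χ 1 = 1 := by
  have h := apply_of_mem_centralWeightSpace (centralPart ρ M).one_mem hv
  rw [map_one, Module.End.one_apply] at h
  exact (smul_left_injective k hv0 (by simpa using h)).symm

theorem weight_inv_mul {χ : ConjFun Γ k} {v : V} (hv : v ∈ centralWeightSpace ρ M χ) (hv0 : v ≠ 0)
    {a b : Γ} (ha : a ∈ centralPart ρ M) (hb : b ∈ centralPart ρ M) (e : χ a = χ b) :
    χ (a⁻¹ * b) = 1 := by
  have h1 := weight_mul hv hv0 ((centralPart ρ M).inv_mem ha) ha
  rw [inv_mul_cancel, weight_one hv hv0] at h1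
  rw [weight_mul hv hv0 ((centralPart ρ M).inv_mem ha) hb, ← e, ← h1]

theorem weight_congr {χ : ConjFun Γ k} {v : V} (hv : v ∈ centralWeightSpace ρ M χ) (hv0 : v ≠ 0)
    {a b : Γ} (ha : a ∈ centralPart ρ M) (hb : b ∈ centralPart ρ M) (e : ρ a = ρ b) :
    χ a = χ b := by
  have h1 := apply_of_mem_centralWeightSpace ha hv
  rw [e, apply_of_mem_centralWeightSpace hb hv] at h1
  exact (smul_left_injective k hv0 h1).symm

/-- The operators are roots of `X ^ (q ^ n) - 1`, which is separable when `q ≠ 0` in the field. -/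
theorem centralFamily_isSemisimple [FiniteDimensional k V] {q : ℕ} (hqk : (q : k) ≠ 0)
    (hM : ∀ m ∈ M, ∃ n, ρ (m ^ q ^ n) = 1) (a : Γ) :
    (centralFamily ρ M a).IsFinitelySemisimple := by
  apply Module.End.IsSemisimple.isFinitelySemisimple
  by_cases ha : a ∈ centralPart ρ M
  · rw [centralFamily_of_mem ha]
    obtain ⟨n, hn⟩ := hM a ha.1
    refine Module.End.isSemisimple_of_squarefree_aeval_eq_zero
      (p := Polynomial.X ^ (q ^ n) - 1) ?_ ?_
    · exact (Polynomial.X_pow_sub_one_separable_iff.2 (by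
        rw [Nat.cast_pow]; exact pow_ne_zero _ hqk)).squarefree
    · rw [map_sub, map_pow, Polynomial.aeval_X, map_one, ← map_pow, hn, sub_self]
  · simp [centralFamily, ha]

/-- An operator of `M` trivial on the image of the norm of `H` is trivial on
every weight space whose weight has trivial stabilizer in `H`. -/
theorem apply_eq_self_of_regular [Finite Γ] [FiniteDimensional k V] {q : ℕ} (hqk : (q : k) ≠ 0)
    (hM : ∀ m ∈ M, ∃ n, ρ (m ^ q ^ n) = 1) {H : Subgroup Γ} [Fintype H]
    (hHM : H ≤ Subgroup.normalizer (M : Set Γ)) {x : Γ} (hx : x ∈ M)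
    (hN : ∀ v, ρ x (∑ h : H, ρ h v) = ∑ h : H, ρ h v) {χ : ConjFun Γ k}
    (hχ : ∀ h ∈ H, h • χ = χ → h = 1) {v : V} (hv : v ∈ centralWeightSpace ρ M χ) :
    ρ x v = v := by
  have hind : iSupIndep fun h : H => centralWeightSpace ρ M ((h : Γ) • χ) := by
    refine (iSupIndep_weightSpace centralFamily_comm
      (centralFamily_isSemisimple hqk hM)).comp (f := fun h : H => ((h : Γ) • χ)) ?_
    intro h h' e
    have := hχ _ (H.mul_mem (H.inv_mem h'.2) h.2) (by
      rw [mul_smul, inv_smul_eq_iff]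
      exact e)
    exact (Subtype.ext (inv_mul_eq_one.1 this)).symm
  -- The translates of `χ` are distinct, so the components of `x N(v) - N(v) = 0` vanish one by one;
  -- the component at `h = 1` is the claim.
  have hz := (iSupIndep_iff_finsetSum_eq_zero_imp_eq_zero _).1 hind Finset.univ
    (fun h => ρ x (ρ h v) - ρ h v) (fun h _ => by
      have := apply_mem_centralWeightSpace (hHM h.2) hv
      exact Submodule.sub_mem _ (apply_mem_centralWeightSpace_of_mem hx this) this)
    (by rw [Finset.sum_sub_distrib, ← map_sum, hN, sub_self]) 1 (Finset.mem_univ _)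
  simpa [sub_eq_zero] using hz

end

/-- Let `H` act semiregularly on `F`, and let `F` and `H` normalize `M`, which acts as a `q`-group
on a vector space `V` over an algebraically closed field in which `q ≠ 0`. Suppose that nonidentity
elements of `H` have no fixed points in the centralizers of `F` in the sections `M / K`. Then
an element of `M` which is trivial on the image of the norm of `H` is trivial on `V`. -/
theorem eq_one_of_trivial_on_norm {Γ k V : Type*} [Group Γ] [Finite Γ] [Field k] [IsAlgClosed k]
    [AddCommGroup V] [Module k V] [FiniteDimensional k V] (ρ : Γ →* Module.End k V)
    {q : ℕ} [Fact q.Prime] (hqk : (q : k) ≠ 0) {M F H : Subgroup Γ} [Fintype H]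
    (hFM : F ≤ Subgroup.normalizer (M : Set Γ)) (hHM : H ≤ Subgroup.normalizer (M : Set Γ))
    (hF : ∀ h ∈ H, ∀ f ∈ F, h * f * h⁻¹ ∈ F)
    (hfpf : ∀ h ∈ H, h ≠ 1 → ∀ f ∈ F, h * f = f * h → f = 1)
    (hM : ∀ m ∈ M, ∃ n, ρ (m ^ q ^ n) = 1)
    (hsec : ∀ h ∈ H, h ≠ 1 → ∀ K ≤ M, (∀ m ∈ M, ∀ a ∈ K, m⁻¹ * a * m ∈ K) →
      (∀ f ∈ F, ∀ a ∈ K, f⁻¹ * a * f ∈ K) → (∀ a ∈ K, h⁻¹ * a * h ∈ K) →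
      ∀ u ∈ M, (∀ f ∈ F, u⁻¹ * (f⁻¹ * u * f) ∈ K) → u⁻¹ * (h⁻¹ * u * h) ∈ K → u ∈ K)
    {x : Γ} (hx : x ∈ M) (hN : ∀ v, ρ x (∑ h : H, ρ h v) = ∑ h : H, ρ h v) : ρ x = 1 := by
  classical
  by_contra hx1
  set Z := centralPart ρ M with hZ
  let regular : ConjFun Γ k → Prop := fun χ => ∀ h ∈ H, h • χ = χ → h = 1
  let N : Subgroup M :=
    { carrier := {m | ∀ χ, regular χ → ∀ v ∈ centralWeightSpace ρ M χ, ρ m v = v}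
      one_mem' := fun χ _ v _ => by simp
      mul_mem' := fun {a b} ha hb χ hχ v hv => by
        rw [Subgroup.coe_mul, map_mul, Module.End.mul_apply, hb χ hχ v hv, ha χ hχ v hv]
      inv_mem' := fun {a} ha χ hχ v hv => by
        conv_lhs => rw [← ha χ hχ v hv]
        rw [← Module.End.mul_apply, ← map_mul]
        simp }
  have hNn : N.Normal := ⟨fun n hn g χ hχ v hv => by
    have hv' := apply_mem_centralWeightSpace_of_mem (M.inv_mem g.2) hv
    have := hn χ hχ _ hv'
    simp only [Subgroup.coe_mul, map_mul, Module.End.mul_apply, InvMemClass.coe_inv]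
    rw [this, ← Module.End.mul_apply, ← map_mul]
    simp⟩
  have hxN : (⟨x, hx⟩ : M) ∈ N := fun χ hχ v hv =>
    apply_eq_self_of_regular hqk hM hHM hx hN hχ hv
  -- The image of `N` in the `q`-group `M / ker` is normal and contains the nontrivial image of `x`,
  -- so it meets the centre.
  obtain ⟨z, hzN, hzZ, hz1⟩ : ∃ z : M, z ∈ N ∧ (z : Γ) ∈ Z ∧ ρ z ≠ 1 := by
    let σ : M →* Module.End k V := ρ.comp M.subtype
    let π := QuotientGroup.mk' σ.ker
    have hQ : IsPGroup q (M ⧸ σ.ker) := by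
      refine isPGroup_iff_pow_pow_eq_one.2 fun g => ?_
      obtain ⟨m, rfl⟩ := QuotientGroup.mk'_surjective _ g
      obtain ⟨n, hn⟩ := hM m m.2
      refine ⟨n, ?_⟩
      rw [← map_pow]
      exact (QuotientGroup.eq_one_iff _).2 hn
    have hNπ : (N.map π).Normal := hNn.map π (QuotientGroup.mk'_surjective _)
    obtain ⟨_, ⟨z, hzN, rfl⟩, hz1, hzc⟩ := exists_mem_center_of_normal hQ (N.map π)
      (Subgroup.mem_map_of_mem π hxN) (fun e => hx1 ((QuotientGroup.eq_one_iff _).1 e))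
    refine ⟨z, hzN, ⟨z.2, fun m hm => ?_⟩, fun e => hz1 ((QuotientGroup.eq_one_iff _).2 e)⟩
    have hc := hzc (π ⟨m, hm⟩)
    rw [← map_mul, ← map_mul] at hc
    have hc' : σ ((⟨m, hm⟩ * z)⁻¹ * (z * ⟨m, hm⟩)) = 1 := QuotientGroup.eq.1 hc
    have : ρ (m * z) * σ ((⟨m, hm⟩ * z)⁻¹ * (z * ⟨m, hm⟩)) = ρ (z * m) := by
      change ρ (m * z) * ρ _ = _
      rw [← map_mul]
      congr 1
      exact mul_inv_cancel_left _ _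
    rw [← this, hc', mul_one]
  obtain ⟨χ, v, hv, hzv⟩ : ∃ χ, ∃ v ∈ centralWeightSpace ρ M χ, ρ z v ≠ v := by
    by_contra! hno
    apply hz1
    have hle : ⨆ χ, centralWeightSpace ρ M χ ≤ LinearMap.eqLocus (ρ z) 1 :=
      iSup_le fun χ v hv => hno χ v hv
    have htop := iSup_weightSpace (f := centralFamily ρ M) centralFamily_comm
      (centralFamily_isSemisimple hqk hM)
    ext v
    exact hle (htop.ge (Submodule.mem_top (x := v)))
  have hv0 : v ≠ 0 := by rintro rfl; simp at hzv
  have hχz : χ z ≠ 1 := fun e => hzv (by rw [apply_of_mem_centralWeightSpace hzZ hv, e, one_smul])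
  obtain ⟨h, hh, hhχ, hh1⟩ : ∃ h ∈ H, h • χ = χ ∧ h ≠ 1 := by
    by_contra! hno
    exact hzv (hzN χ hno v hv)
  have hρ0 : ∀ g, ρ g v ≠ 0 := fun g e => hv0 (by
    have : ρ g⁻¹ (ρ g v) = v := by rw [← Module.End.mul_apply, ← map_mul]; simp
    rw [← this, e, map_zero])
  have hw : ∀ f ∈ F, ρ f v ∈ centralWeightSpace ρ M (f • χ) := fun f hf =>
    apply_mem_centralWeightSpace (hFM hf) hv
  have hzf : ∀ f ∈ F, f • χ ≠ χ → (f • χ) z = 1 := by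
    intro f hf hne
    have := hzN (f • χ) (fun h' hh' e => by
      by_contra h1'
      exact hne (eq_of_nonregular hF hfpf hf hh hh1 hhχ hh' h1' e)) _ (hw f hf)
    rw [apply_of_mem_centralWeightSpace hzZ (hw f hf)] at this
    exact smul_left_injective k (hρ0 f) (by simpa using this)
  have hχmul : ∀ f ∈ F, ∀ a ∈ Z, ∀ b ∈ Z, (f • χ) (a * b) = (f • χ) a * (f • χ) b :=
    fun f hf a ha b hb => weight_mul (hw f hf) (hρ0 f) ha hb
  have hsm : ∀ g g' a, (g' • χ) (g⁻¹ * a * g) = ((g * g') • χ) a := fun g g' a => by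
    rw [mul_smul, ConjFun.smul_apply g]
  -- The conjugate of `z` by `g` takes the value `χ z` at `g • χ` and `1` elsewhere on the
  -- `F`-orbit, since all weights of the orbit except `χ` are regular. One conjugate is multiplied
  -- in per weight.
  have hy : ∀ S : Finset (ConjFun Γ k), (∀ ψ ∈ S, ∃ f ∈ F, f • χ = ψ) →
      ∃ y ∈ Z, ∀ f ∈ F, (f • χ) y = if f • χ ∈ S then χ z else 1 := by
    intro S
    induction S using Finset.induction_on with
    | empty => exact fun _ => ⟨1, Z.one_mem, fun f hf => by simp [weight_one (hw f hf) (hρ0 f)]⟩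
    | insert ψ S hψ ih =>
      intro hS
      obtain ⟨y, hyZ, hy⟩ := ih fun φ hφ => hS φ (Finset.mem_insert_of_mem hφ)
      obtain ⟨g, hg, rfl⟩ := hS ψ (Finset.mem_insert_self _ _)
      have hzg : g * z * g⁻¹ ∈ Z := by
        simpa using conj_mem_centralPart (Subgroup.inv_mem _ (hFM hg)) hzZ
      refine ⟨y * (g * z * g⁻¹), Z.mul_mem hyZ hzg, fun f hf => ?_⟩
      have e : (f • χ) (g * z * g⁻¹) = ((g⁻¹ * f) • χ) z := by
        have := hsm g⁻¹ f z
        rwa [inv_inv] at this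
      rw [hχmul f hf _ hyZ _ hzg, hy f hf, e]
      by_cases hfg : f • χ = g • χ
      · rw [hfg, if_neg hψ, if_pos (Finset.mem_insert_self _ _), mul_smul, hfg, inv_smul_smul,
          one_mul]
      · rw [hzf _ (F.mul_mem (F.inv_mem hg) hf) (fun e => hfg (by
          rw [mul_smul, inv_smul_eq_iff] at e; exact e)), mul_one]
        simp [Finset.mem_insert, hfg]
  obtain ⟨y, hyZ, hy⟩ : ∃ y ∈ Z, ∀ f ∈ F, (f • χ) y = χ z := by
    have hfin : (Set.range fun f : F => (f : Γ) • χ).Finite := Set.finite_range _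
    obtain ⟨y, hyZ, hy⟩ := hy hfin.toFinset (by simp)
    refine ⟨y, hyZ, fun f hf => ?_⟩
    rw [hy f hf, if_pos]
    rw [Set.Finite.mem_toFinset]
    exact ⟨⟨f, hf⟩, rfl⟩
  -- The common kernel of the weights in the `F`-orbit of `χ`; modulo it an element of `Z` is
  -- determined by its values there.
  let K : Subgroup Γ :=
    { carrier := {a | a ∈ Z ∧ ∀ f ∈ F, (f • χ) a = 1}
      one_mem' := ⟨Z.one_mem, fun f hf => weight_one (hw f hf) (hρ0 f)⟩
      mul_mem' := fun {a b} ha hb => ⟨Z.mul_mem ha.1 hb.1, fun f hf => by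
        rw [hχmul f hf _ ha.1 _ hb.1, ha.2 f hf, hb.2 f hf, one_mul]⟩
      inv_mem' := fun {a} ha => ⟨Z.inv_mem ha.1, fun f hf => by
        have := weight_inv_mul (hw f hf) (hρ0 f) ha.1 Z.one_mem
          ((ha.2 f hf).trans (weight_one (hw f hf) (hρ0 f)).symm)
        rwa [mul_one] at this⟩ }
  have hconjH : ∀ f ∈ F, ∃ g ∈ F, ∀ a, (f • χ) (h⁻¹ * a * h) = (g • χ) a := by
    intro f hf
    refine ⟨h * f * h⁻¹, hF h hh f hf, fun a => ?_⟩
    rw [hsm]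
    conv_lhs => rw [show h * f = h * f * h⁻¹ * h by group, mul_smul, hhχ]
  have hquot : ∀ a ∈ Z, ∀ b ∈ Z, (∀ f ∈ F, (f • χ) a = (f • χ) b) → a⁻¹ * b ∈ K :=
    fun a ha b hb e => ⟨Z.mul_mem (Z.inv_mem ha) hb, fun f hf =>
      weight_inv_mul (hw f hf) (hρ0 f) ha hb (e f hf)⟩
  -- `F` and `h` permute the orbit, on which `y` is constant, so they fix `y` modulo `K` and `hsec`
  -- applies.
  have hyK : y ∈ K := by
    refine hsec h hh hh1 K (fun a ha => ha.1.1) ?_ ?_ ?_ y hyZ.1 ?_ ?_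
    · intro m hm a ha
      have hmem : m⁻¹ * a * m ∈ Z := conj_mem_centralPart (Subgroup.le_normalizer hm) ha.1
      refine ⟨hmem, fun f hf => ?_⟩
      rw [weight_congr (hw f hf) (hρ0 f) hmem ha.1, ha.2 f hf]
      rw [mul_assoc, map_mul, ha.1.2 m hm, ← map_mul]
      congr 1
      group
    · intro f hf a ha
      exact ⟨conj_mem_centralPart (hFM hf) ha.1, fun g hg => by
        rw [hsm, ha.2 _ (F.mul_mem hf hg)]⟩
    · intro a ha
      refine ⟨conj_mem_centralPart (hHM hh) ha.1, fun f hf => ?_⟩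
      obtain ⟨g, hg, e⟩ := hconjH f hf
      rw [e, ha.2 g hg]
    · intro f hf
      refine hquot _ hyZ _ (conj_mem_centralPart (hFM hf) hyZ) fun g hg => ?_
      rw [hsm, hy g hg, hy _ (F.mul_mem hf hg)]
    · refine hquot _ hyZ _ (conj_mem_centralPart (hHM hh) hyZ) fun f hf => ?_
      obtain ⟨g, hg, e⟩ := hconjH f hf
      rw [e, hy g hg, hy f hf]
  have h1 := hyK.2 1 F.one_mem
  rw [hy 1 F.one_mem] at h1
  exact hχz h1

/-! ### Transfer to abelian `p`-groups through the dual -/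

section DualRep

variable {Γ A : Type*} [Group Γ] [CommGroup A]

/-- The representation of a group acting on `A` on the homomorphisms from `A` to a field. -/
def dualRep (k : Type*) [Field k] (θ : Γ →* MulAut A) : Γ →* Module.End k (Additive A →+ k) where
  toFun g :=
    { toFun := fun φ => φ.comp (MonoidHom.toAdditive (θ g⁻¹).toMonoidHom)
      map_add' := fun _ _ => rfl
      map_smul' := fun _ _ => rfl }
  map_one' := by ext φ a; simp
  map_mul' g g' := by
    ext φ a
    simp

theorem dualRep_apply {k : Type*} [Field k] (θ : Γ →* MulAut A) (g : Γ) (φ : Additive A →+ k)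
    (a : A) : dualRep k θ g φ (.ofMul a) = φ (.ofMul (θ g⁻¹ a)) := rfl

/-- `A` is a vector space over `ZMod p`, whose functionals separate points and remain separating
after embedding `ZMod p` in `k`. -/
theorem eq_one_of_dualRep_eq_one {k : Type*} [Field k] {p : ℕ} [Fact p.Prime] [CharP k p]
    (hA : ∀ a : A, a ^ p = 1) {θ : Γ →* MulAut A} {g : Γ} (hg : dualRep k θ g = 1) :
    θ g = 1 := by
  let _ : Module (ZMod p) (Additive A) := AddCommGroup.zmodModule (n := p) fun a => hA a.toMul
  let _ : Algebra (ZMod p) k := ZMod.algebra k p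
  have key : ∀ a, θ g⁻¹ a = a := by
    intro a
    by_contra hne
    have h0 : (Additive.ofMul (θ g⁻¹ a) - Additive.ofMul a) ≠ 0 := fun e => hne (by
      simpa using sub_eq_zero.1 e)
    obtain ⟨ψ, hψ⟩ : ∃ ψ : Module.Dual (ZMod p) (Additive A),
        ψ (Additive.ofMul (θ g⁻¹ a) - Additive.ofMul a) ≠ 0 := by
      by_contra! hno
      exact h0 ((Module.forall_dual_apply_eq_zero_iff (ZMod p) _).1 hno)
    have := DFunLike.congr_fun (DFunLike.congr_fun hg
      ((algebraMap (ZMod p) k).toAddMonoidHom.comp ψ.toAddMonoidHom)) (Additive.ofMul a)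
    rw [dualRep_apply] at this
    have h2 : ψ (Additive.ofMul (θ g⁻¹ a)) = ψ (Additive.ofMul a) :=
      (algebraMap (ZMod p) k).injective this
    exact hψ (by rw [map_sub, h2, sub_self])
  have : θ g⁻¹ = 1 := MulEquiv.ext key
  rwa [map_inv, inv_eq_one] at this

instance {k : Type*} [Field k] [Finite A] : FiniteDimensional k (Additive A →+ k) :=
  Module.Finite.of_injective
    ({ toFun := fun φ => φ, map_add' := fun _ _ => rfl, map_smul' := fun _ _ => rfl } :
      (Additive A →+ k) →ₗ[k] (Additive A → k)) DFunLike.coe_injective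

end DualRep

/-- Let `H` act semiregularly on `F`, and let `F` and `H` normalize `M`, which acts as a `q`-group
on an abelian group `A` of prime exponent `p ≠ q`. Suppose that nonidentity
elements of `H` have no fixed points in the centralizers of `F` in the sections `M / K`. Then
an element of `M` commuting with `H` and trivial on the norms of `H` is trivial on `A`. -/
theorem action_eq_one_of_trivial_on_norm {Γ A : Type*} [Group Γ] [Finite Γ] [CommGroup A] [Finite A]
    (θ : Γ →* MulAut A) {p q : ℕ} [Fact p.Prime] [Fact q.Prime] (hpq : p ≠ q)
    (hA : ∀ a : A, a ^ p = 1) {M F H : Subgroup Γ} [Fintype H]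
    (hFM : F ≤ Subgroup.normalizer (M : Set Γ)) (hHM : H ≤ Subgroup.normalizer (M : Set Γ))
    (hF : ∀ h ∈ H, ∀ f ∈ F, h * f * h⁻¹ ∈ F)
    (hfpf : ∀ h ∈ H, h ≠ 1 → ∀ f ∈ F, h * f = f * h → f = 1)
    (hM : ∀ m ∈ M, ∃ n, θ (m ^ q ^ n) = 1)
    (hsec : ∀ h ∈ H, h ≠ 1 → ∀ K ≤ M, (∀ m ∈ M, ∀ a ∈ K, m⁻¹ * a * m ∈ K) →
      (∀ f ∈ F, ∀ a ∈ K, f⁻¹ * a * f ∈ K) → (∀ a ∈ K, h⁻¹ * a * h ∈ K) →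
      ∀ u ∈ M, (∀ f ∈ F, u⁻¹ * (f⁻¹ * u * f) ∈ K) → u⁻¹ * (h⁻¹ * u * h) ∈ K → u ∈ K)
    {x : Γ} (hx : x ∈ M) (hxH : ∀ h ∈ H, x * h = h * x)
    (hN : ∀ a, θ x (∏ h : H, θ h a) = ∏ h : H, θ h a) : θ x = 1 := by
  let k := AlgebraicClosure (ZMod p)
  have : CharP k p := charP_of_injective_algebraMap (algebraMap (ZMod p) k).injective p
  refine eq_one_of_dualRep_eq_one (k := k) hA ?_
  have hqk : (q : k) ≠ 0 := by
    rw [Ne, CharP.cast_eq_zero_iff k p]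
    intro hd
    exact hpq ((Nat.prime_dvd_prime_iff_eq Fact.out Fact.out).1 hd)
  refine eq_one_of_trivial_on_norm (dualRep k θ) hqk hFM hHM hF hfpf ?_ hsec hx ?_
  · intro m hm
    obtain ⟨n, hn⟩ := hM m hm
    refine ⟨n, ?_⟩
    refine LinearMap.ext fun φ => DFunLike.ext _ _ fun a => ?_
    change φ (Additive.ofMul (θ (m ^ q ^ n)⁻¹ a.toMul)) = φ a
    rw [map_inv, hn]
    rfl
  · intro φ
    refine DFunLike.ext _ _ fun a' => ?_
    obtain ⟨a, rfl⟩ := Additive.ofMul.surjective a'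
    have hN' : ∀ b, ∏ h : H, θ (h : Γ)⁻¹ b = ∏ h : H, θ h b := fun b =>
      Fintype.prod_equiv (Equiv.inv H) _ _ fun h => rfl
    -- As `x` commutes with `H`, it can be moved past the norm, which it fixes.
    have hxN : ∏ h : H, θ h (θ x⁻¹ a) = ∏ h : H, θ h a := by
      have e : ∀ h : H, θ h (θ x⁻¹ a) = θ x⁻¹ (θ h a) := fun h => by
        rw [← MulAut.mul_apply, ← map_mul, ← MulAut.mul_apply, ← map_mul]
        congr 2
        rw [eq_inv_mul_iff_mul_eq, ← mul_assoc, hxH h h.2, mul_inv_cancel_right]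
      rw [Finset.prod_congr rfl fun h _ => e h, ← map_prod, map_inv, MulAut.inv_apply,
        MulEquiv.symm_apply_eq, hN]
    have hsum : ∀ b, (∑ h : H, dualRep k θ h φ) (Additive.ofMul b)
        = φ (Additive.ofMul (∏ h : H, θ h b)) := by
      intro b
      rw [AddMonoidHom.finsetSum_apply, ← hN', ofMul_prod, map_sum]
      rfl
    rw [dualRep_apply, hsum, hsum, hxN]

/-! ### `π`-groups and `π`-cores -/

theorem IsPiGroup.of_dvd {π : Set Nat.Primes} {X Y : Type*} [Group X] [Group Y]
    (hX : IsPiGroup π X) (h : Nat.card Y ∣ Nat.card X) : IsPiGroup π Y :=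
  fun p hp => hX p (hp.trans h)

theorem IsPiGroup.of_injective {π : Set Nat.Primes} {X Y : Type*} [Group X] [Group Y]
    (hX : IsPiGroup π X) (f : Y →* X) (hf : Function.Injective f) : IsPiGroup π Y :=
  hX.of_dvd (Subgroup.card_dvd_of_injective f hf)

theorem IsPiGroup.of_surjective {π : Set Nat.Primes} {X Y : Type*} [Group X] [Group Y]
    (hX : IsPiGroup π X) (f : X →* Y) (hf : Function.Surjective f) : IsPiGroup π Y :=
  hX.of_dvd (Subgroup.card_dvd_of_surjective f hf)

theorem IsPiGroup.to_le {π : Set Nat.Primes} {X : Type*} [Group X] {A B : Subgroup X}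
    (hB : IsPiGroup π B) (h : A ≤ B) : IsPiGroup π A :=
  hB.of_dvd (Subgroup.card_dvd_of_le h)

theorem IsPiGroup.map {π : Set Nat.Primes} {X Y : Type*} [Group X] [Group Y] {A : Subgroup X}
    (hA : IsPiGroup π A) (f : X →* Y) : IsPiGroup π (A.map f) :=
  hA.of_surjective (f.subgroupMap A) (f.subgroupMap_surjective A)

theorem IsPiGroup.mono {π π' : Set Nat.Primes} {X : Type*} [Group X]
    (hX : IsPiGroup π X) (h : π ⊆ π') : IsPiGroup π' X :=
  fun p hp => h (hX p hp)

theorem IsPiGroup.of_isPGroup {p : Nat.Primes} {X : Type*} [Group X] [Finite X]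
    (hX : IsPGroup p X) {π : Set Nat.Primes} (hp : p ∈ π) : IsPiGroup π X := by
  have := Fact.mk p.2
  intro q hq
  obtain ⟨n, hn⟩ := hX.exists_card_eq
  rw [hn] at hq
  have : (q : ℕ) = p := (Nat.prime_dvd_prime_iff_eq q.2 p.2).1 (q.2.dvd_of_dvd_pow hq)
  rwa [Subtype.ext this]

theorem IsPiGroup.isPGroup {p : Nat.Primes} {X : Type*} [Group X] [Finite X]
    (hX : IsPiGroup {p} X) : IsPGroup p X := by
  have := Fact.mk p.2
  refine IsPGroup.of_card (n := (Nat.card X).primeFactorsList.length) ?_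
  exact Nat.eq_prime_pow_of_unique_prime_dvd Nat.card_pos.ne' fun {d} hd hdvd =>
    congrArg Subtype.val (hX ⟨d, hd⟩ hdvd)

theorem coprime_card_of_isPiGroup {π : Set Nat.Primes} {X Y : Type*} [Group X] [Group Y]
    [Finite X] [Finite Y] (hX : IsPiGroup π X) (hY : IsPiGroup πᶜ Y) :
    (Nat.card X).Coprime (Nat.card Y) :=
  Nat.coprime_of_dvd fun p hp h1 h2 => hY ⟨p, hp⟩ h2 (hX ⟨p, hp⟩ h1)

theorem card_sup_dvd {X : Type*} [Group X] [Finite X] (A B : Subgroup X) [A.Normal] :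
    Nat.card (A ⊔ B : Subgroup X) ∣ Nat.card A * Nat.card B := by
  rw [← Subgroup.relIndex_bot_left (A ⊔ B), ← Subgroup.relIndex_mul_relIndex ⊥ A (A ⊔ B) bot_le
    le_sup_left, Subgroup.relIndex_bot_left, Subgroup.relIndex_sup_left]
  exact Nat.mul_dvd_mul_left _ (Subgroup.relIndex_dvd_card _ _)

theorem IsPiGroup.sup {π : Set Nat.Primes} {X : Type*} [Group X] [Finite X] {A B : Subgroup X}
    [A.Normal] (hA : IsPiGroup π A) (hB : IsPiGroup π B) : IsPiGroup π (A ⊔ B : Subgroup X) := by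
  intro p hp
  rcases (p.2.dvd_mul).1 (hp.trans (card_sup_dvd A B)) with h | h
  exacts [hA p h, hB p h]

theorem le_piCore {π : Set Nat.Primes} {X : Type*} [Group X] {A : Subgroup X} (hA : A.Normal)
    (h : IsPiGroup π A) : A ≤ piCore π X :=
  le_sSup ⟨hA, h⟩

theorem piCore_isPiGroup (π : Set Nat.Primes) (X : Type*) [Group X] [Finite X] :
    IsPiGroup π (piCore π X) := by
  obtain ⟨A, hA⟩ := (Set.toFinite {N : Subgroup X | N.Normal ∧ IsPiGroup π N}).exists_maximal
    ⟨⊥, inferInstance, fun p hp => by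
      simp only [Subgroup.card_bot, Nat.dvd_one] at hp
      exact (p.2.one_lt.ne' hp).elim⟩
  have : piCore π X ≤ A := sSup_le fun B hB => by
    have := hA.1.1
    have := hB.1
    exact le_sup_right.trans (hA.2 ⟨Subgroup.sup_normal A B, hA.1.2.sup hB.2⟩ le_sup_left)
  exact hA.1.2.to_le this

theorem map_piCore_le {π : Set Nat.Primes} {X Y : Type*} [Group X] [Group Y] [Finite X]
    (f : X →* Y) (hf : Function.Surjective f) : (piCore π X).map f ≤ piCore π Y :=
  le_piCore ((piCore_normal π X).map f hf) ((piCore_isPiGroup π X).map f)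

theorem map_piCore {π : Set Nat.Primes} {X Y : Type*} [Group X] [Group Y] [Finite X] [Finite Y]
    (e : X ≃* Y) : (piCore π X).map e.toMonoidHom = piCore π Y := by
  refine le_antisymm (map_piCore_le _ e.surjective) ?_
  have := Subgroup.map_mono (f := e.toMonoidHom)
    (map_piCore_le (π := π) e.symm.toMonoidHom e.symm.surjective)
  rw [Subgroup.map_map] at this
  simpa using this

theorem comap_piCore_le {π : Set Nat.Primes} {X Y : Type*} [Group X] [Group Y] [Finite Y]
    (f : X →* Y) (hf : Function.Injective f) : (piCore π Y).comap f ≤ piCore π X := by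
  refine le_piCore ((piCore_normal π Y).comap f) ?_
  refine (piCore_isPiGroup π Y).of_injective
    ((f.comp (Subgroup.subtype _)).codRestrict _ fun x => x.2) ?_
  intro x y h
  exact Subtype.ext (hf (congrArg Subtype.val h))

theorem comap_piCore_quotient {π : Set Nat.Primes} {X Y : Type*} [Group X] [Group Y] [Finite X]
    [Finite Y] (f : X →* Y) (hf : Function.Surjective f) (N : Subgroup X) [N.Normal]
    (hN : N = f.ker) :
    (piCore π (X ⧸ N)).comap (QuotientGroup.mk' N) = (piCore π Y).comap f := by
  subst hN
  rw [← map_piCore (QuotientGroup.quotientKerEquivOfSurjective f hf)]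
  ext x
  refine ⟨fun h => ⟨_, h, rfl⟩, fun ⟨y, hy, e⟩ => ?_⟩
  have : y = QuotientGroup.mk' f.ker x := (QuotientGroup.quotientKerEquivOfSurjective f hf).injective e
  exact (this ▸ hy : QuotientGroup.mk' f.ker x ∈ piCore π (X ⧸ f.ker))

theorem eq_top_of_sylow_le {X : Type*} [Group X] [Finite X] (A : Subgroup X)
    (h : ∀ (p : ℕ) [Fact p.Prime] (P : Sylow p X), (P : Subgroup X) ≤ A) : A = ⊤ := by
  rw [← Subgroup.index_eq_one]
  by_contra hne
  obtain ⟨p, hp, hd⟩ := Nat.exists_prime_and_dvd hne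
  have := Fact.mk hp
  let P : Sylow p X := default
  exact P.not_dvd_index (hd.trans (Subgroup.index_dvd_of_le (h p P)))

/-- Every Sylow subgroup of a nilpotent group is normal, hence lies in one of the two cores. -/
theorem piCore_sup_piCore_compl (π : Set Nat.Primes) (X : Type*) [Group X] [Finite X]
    [Group.IsNilpotent X] : piCore π X ⊔ piCore πᶜ X = ⊤ := by
  refine eq_top_of_sylow_le _ fun p _ P => ?_
  have hPn : (P : Subgroup X).Normal :=
    Sylow.normal_of_normalizerCondition Group.normalizerCondition_of_isNilpotent P
  by_cases hp : (⟨p, Fact.out⟩ : Nat.Primes) ∈ π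
  · exact le_sup_of_le_left (le_piCore hPn (IsPiGroup.of_isPGroup (p := ⟨p, Fact.out⟩) P.2 hp))
  · exact le_sup_of_le_right (le_piCore hPn (IsPiGroup.of_isPGroup (p := ⟨p, Fact.out⟩) P.2 hp))

theorem disjoint_piCore_compl (π : Set Nat.Primes) (X : Type*) [Group X] [Finite X] :
    Disjoint (piCore π X) (piCore πᶜ X) := by
  exact Subgroup.disjoint_of_coprime_natCard
    (coprime_card_of_isPiGroup (piCore_isPiGroup π X) (piCore_isPiGroup πᶜ X))

theorem commute_piCore_compl {π : Set Nat.Primes} {X : Type*} [Group X] [Finite X] {a b : X}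
    (ha : a ∈ piCore π X) (hb : b ∈ piCore πᶜ X) : a * b = b * a :=
  Subgroup.commute_of_normal_of_disjoint _ _ (piCore_normal π X) (piCore_normal πᶜ X)
    (disjoint_piCore_compl π X) a b ha hb

/-! ### Elementary abelian subgroups and vanishing of cocycles -/

/-- A nontrivial normal subgroup of a finite solvable group contains a nontrivial abelian subgroup
of prime exponent which is invariant under all automorphisms preserving the given subgroup. -/
theorem exists_elementary_abelian {G : Type*} [Group G] [Finite G] [Group.IsSolvable G]
    {N : Subgroup G} (hN : N ≠ ⊥) :
    ∃ p : ℕ, p.Prime ∧ ∃ A ≤ N, A ≠ ⊥ ∧ (∀ a ∈ A, a ^ p = 1) ∧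
      (∀ a ∈ A, ∀ b ∈ A, a * b = b * a) ∧
      ∀ ψ : MulAut G, (∀ x ∈ N, ψ x ∈ N) → ∀ a ∈ A, ψ a ∈ A := by
  let S : Set (Subgroup G) := {B | B ≤ N ∧ B ≠ ⊥ ∧
    ∀ ψ : MulAut G, (∀ x ∈ N, ψ x ∈ N) → ∀ a ∈ B, ψ a ∈ B}
  -- The commutator subgroup of a minimal `B` is again invariant and, by solvability, smaller, so it
  -- is trivial. The `p`-torsion of `B` then serves as `A`.
  obtain ⟨B, hB⟩ := (Set.toFinite S).exists_minimal ⟨N, le_rfl, hN, fun _ h => h⟩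
  have hcomm : ⁅B, B⁆ = ⊥ := by
    by_contra hne
    have hmem : ⁅B, B⁆ ∈ S := by
      refine ⟨(Subgroup.commutator_le_self B).trans hB.1.1, hne, fun ψ hψ a ha => ?_⟩
      have hle : ⁅B, B⁆.map ψ.toMonoidHom ≤ ⁅B, B⁆ := by
        rw [Subgroup.map_commutator]
        have : B.map ψ.toMonoidHom ≤ B := by
          rintro _ ⟨b, hb, rfl⟩
          exact hB.1.2.2 ψ hψ b hb
        exact Subgroup.commutator_mono this this
      exact hle ⟨a, ha, rfl⟩
    exact (Group.IsSolvable.commutator_lt_of_ne_bot hB.1.2.1).not_ge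
      (hB.2 hmem (Subgroup.commutator_le_self B))
  have hab : ∀ a ∈ B, ∀ b ∈ B, a * b = b * a := fun a ha b hb =>
    commutatorElement_eq_one_iff_mul_comm.1 (by
      have := Subgroup.commutator_mem_commutator ha hb
      rwa [hcomm, Subgroup.mem_bot] at this)
  have hcard : Nat.card B ≠ 1 := fun e => hB.1.2.1 (Subgroup.card_eq_one.1 e)
  obtain ⟨p, hp, hd⟩ := Nat.exists_prime_and_dvd hcard
  have := Fact.mk hp
  obtain ⟨b, hb⟩ := exists_prime_orderOf_dvd_card' p hd
  let A : Subgroup G :=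
    { carrier := {a | a ∈ B ∧ a ^ p = 1}
      one_mem' := ⟨B.one_mem, one_pow p⟩
      mul_mem' := fun {a b} ha hb => ⟨B.mul_mem ha.1 hb.1, by
        rw [Commute.mul_pow (hab a ha.1 b hb.1), ha.2, hb.2, one_mul]⟩
      inv_mem' := fun {a} ha => ⟨B.inv_mem ha.1, by rw [inv_pow, ha.2, inv_one]⟩ }
  refine ⟨p, hp, A, fun a ha => hB.1.1 ha.1, fun e => ?_, fun a ha => ha.2,
    fun a ha b hb => hab a ha.1 b hb.1, fun ψ hψ a ha =>
      ⟨hB.1.2.2 ψ hψ a ha.1, by rw [← map_pow, ha.2, map_one]⟩⟩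
  have hbA : (b : G) ∈ A := ⟨b.2, by rw [← hb, ← Subgroup.coe_pow, pow_orderOf_eq_one]; rfl⟩
  rw [e, Subgroup.mem_bot] at hbA
  have : b = 1 := Subtype.ext hbA
  rw [this, orderOf_one] at hb
  exact hp.one_lt.ne hb

section Cocycle

variable {S A : Type*} [Group S] [Fintype S] [CommGroup A] (θ : S →* MulAut A)

/-- Shapiro-Higman averaging: the trace of an endomorphism `e` kills the first cohomology. -/
theorem exists_prod_eq_coboundary (e : A →* A) {c : S → A} (hc : ∀ s t, c (s * t) = c s * θ s (c t)) :
    ∃ v, ∀ s, ∏ h, θ h (e (θ h⁻¹ (c s))) = v * (θ s v)⁻¹ := by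
  refine ⟨∏ h, θ h (e (θ h⁻¹ (c h))), fun s => ?_⟩
  rw [eq_mul_inv_iff_mul_eq, map_prod]
  have h1 : ∏ h, θ s (θ h (e (θ h⁻¹ (c h)))) = ∏ k, θ k (e (θ k⁻¹ (θ s (c (s⁻¹ * k))))) := by
    refine Fintype.prod_equiv (Equiv.mulLeft s) _ _ fun h => ?_
    simp only [Equiv.coe_mulLeft, inv_mul_cancel_left, mul_inv_rev, map_mul, MulAut.mul_apply]
    congr 3
    rw [map_inv θ s, MulAut.inv_apply_self]
  rw [h1, ← Finset.prod_mul_distrib]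
  refine Finset.prod_congr rfl fun k _ => ?_
  rw [← map_mul, ← map_mul, ← map_mul, ← hc, mul_inv_cancel_left]

/-- The trace of the identity is the power map with exponent `|S|`, which is invertible on `A`. -/
theorem exists_coboundary_of_coprime [Finite A] (hco : (Nat.card S).Coprime (Nat.card A))
    {c : S → A} (hc : ∀ s t, c (s * t) = c s * θ s (c t)) : ∃ v, ∀ s, c s = v * (θ s v)⁻¹ := by
  obtain ⟨v, hv⟩ := exists_prod_eq_coboundary θ (MonoidHom.id A) hc
  obtain ⟨w, rfl⟩ := (powCoprime hco.symm).surjective v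
  refine ⟨w, fun s => (powCoprime hco.symm).injective ?_⟩
  have := hv s
  simp only [MonoidHom.id_apply, powCoprime_apply] at this ⊢
  rw [mul_pow, inv_pow, ← map_pow, ← this]
  simp

end Cocycle

/-! ### Carter subgroups and their images in quotients -/

/-- The restriction of an action by automorphisms to an invariant subgroup. -/
def restrictHom {S G : Type*} [Group S] [Group G] (φ : S →* MulAut G) (A : Subgroup G)
    (hA : ∀ s, ∀ a ∈ A, φ s a ∈ A) : S →* MulAut A where
  toFun s :=
    { toFun := fun x => ⟨φ s x, hA s x x.2⟩
      invFun := fun x => ⟨φ s⁻¹ x, hA _ x x.2⟩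
      left_inv := fun x => Subtype.ext (by simp)
      right_inv := fun x => Subtype.ext (by simp)
      map_mul' := fun x y => Subtype.ext (map_mul (φ s) (x : G) (y : G)) }
  map_one' := by ext; simp
  map_mul' _ _ := by ext; simp

@[simp] theorem coe_restrictHom {S G : Type*} [Group S] [Group G] (φ : S →* MulAut G)
    (A : Subgroup G) (hA : ∀ s, ∀ a ∈ A, φ s a ∈ A) (s : S) (a : A) :
    (restrictHom φ A hA s a : G) = φ s a := rfl

theorem mem_normalizer_of_conj_mem {G : Type*} [Group G] [Finite G] {F : Subgroup G} {g : G}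
    (h : ∀ f ∈ F, g * f * g⁻¹ ∈ F) : g ∈ Subgroup.normalizer (F : Set G) := by
  have hle : F.map (MulAut.conj g).toMonoidHom ≤ F := by
    rintro _ ⟨f, hf, rfl⟩
    exact h f hf
  have heq : F.map (MulAut.conj g).toMonoidHom = F :=
    Subgroup.eq_of_le_of_card_ge hle
      (Nat.card_congr (F.equivMapOfInjective _ (MulAut.conj g).injective).toEquiv).le
  refine Subgroup.mem_normalizer_iff.2 fun f => ⟨h f, fun hf => ?_⟩
  rw [← heq] at hf
  obtain ⟨f', hf', e⟩ := hf
  have : f' = f := (MulAut.conj g).injective e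
  exact this ▸ hf'

/-- The largest `π`-subgroup of a nilpotent subgroup, as a subgroup of the whole group. -/
def hallPart {G : Type*} [Group G] (π : Set Nat.Primes) (F : Subgroup G) : Subgroup G :=
  (piCore π F).map F.subtype

theorem hallPart_le {G : Type*} [Group G] {F : Subgroup G} {π : Set Nat.Primes} :
    hallPart π F ≤ F := Subgroup.map_subtype_le _

section HallPart

variable {G : Type*} [Group G] [Finite G] {F : Subgroup G} {π : Set Nat.Primes}

theorem isPiGroup_hallPart : IsPiGroup π (hallPart π F) := (piCore_isPiGroup π F).map _

theorem commute_hallPart {a b : G} (ha : a ∈ hallPart π F) (hb : b ∈ hallPart πᶜ F) :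
    a * b = b * a := by
  obtain ⟨a, ha, rfl⟩ := ha
  obtain ⟨b, hb, rfl⟩ := hb
  exact congrArg F.subtype (commute_piCore_compl ha hb)

theorem exists_eq_mul_hallPart [Group.IsNilpotent F] {f : G} (hf : f ∈ F) :
    ∃ a ∈ hallPart π F, ∃ b ∈ hallPart πᶜ F, f = a * b := by
  have := piCore_normal π F
  have h : (⟨f, hf⟩ : F) ∈ piCore π F ⊔ piCore πᶜ F := by
    rw [piCore_sup_piCore_compl]; trivial
  obtain ⟨a, ha, b, hb, e⟩ := Subgroup.mem_sup_of_normal_left.1 h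
  exact ⟨a, ⟨a, ha, rfl⟩, b, ⟨b, hb, rfl⟩, (congrArg Subtype.val e).symm⟩

theorem hallPart_invariant {ψ : MulAut G} (hψ : ∀ x ∈ F, ψ x ∈ F) :
    ∀ x ∈ hallPart π F, ψ x ∈ hallPart π F := by
  rintro _ ⟨x, hx, rfl⟩
  let f : F →* F := (ψ.toMonoidHom.comp F.subtype).codRestrict F fun x => hψ x x.2
  have hinj : Function.Injective f := fun x y e =>
    Subtype.ext (ψ.injective (congrArg Subtype.val e))
  exact ⟨f x, map_piCore_le f (Finite.injective_iff_surjective.1 hinj) ⟨x, hx, rfl⟩, rfl⟩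

/-- A `p`-subgroup containing the `p`-part of a Carter subgroup and centralizing its `p'`-part lies
in the Carter subgroup. -/
theorem IsCarter.le_of_isPGroup (hF : IsCarter F) {p : Nat.Primes} {S : Subgroup G}
    (hS : IsPGroup p S) (hle : hallPart {p} F ≤ S)
    (hc : ∀ s ∈ S, ∀ b ∈ hallPart {p}ᶜ F, s * b = b * s) : S ≤ F := by
  have := Fact.mk p.2
  have := hF.nilpotent
  by_contra hSF
  have hnil : Group.IsNilpotent S := hS.isNilpotent
  have hlt : F.subgroupOf S < ⊤ := lt_top_iff_ne_top.2 fun e => hSF (Subgroup.subgroupOf_eq_top.1 e)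
  obtain ⟨s, hs, hsF⟩ := SetLike.exists_of_lt (Group.normalizerCondition_of_isNilpotent _ hlt)
  apply hsF
  rw [Subgroup.mem_subgroupOf, ← hF.self_normalizing]
  refine mem_normalizer_of_conj_mem fun f hf => ?_
  obtain ⟨a, ha, b, hb, rfl⟩ := exists_eq_mul_hallPart (π := {p}) hf
  have h1 : (s : G) * a * (s : G)⁻¹ ∈ F :=
    (Subgroup.mem_normalizer_iff.1 hs ⟨a, hle ha⟩).1 (hallPart_le ha : a ∈ F)
  have h2 : (s : G) * (a * b) * (s : G)⁻¹ = (s : G) * a * (s : G)⁻¹ * b := by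
    have := hc _ (S.inv_mem s.2) b hb
    rw [mul_assoc, mul_assoc a, ← this]
    group
  rw [h2]
  exact F.mul_mem h1 (hallPart_le hb)

/-- Elements of a normal `p`-subgroup centralizing the `p'`-part of a Carter subgroup lie in the
Carter subgroup. -/
theorem IsCarter.mem_of_commute (hF : IsCarter F) {p : Nat.Primes} {A : Subgroup G} [A.Normal]
    (hA : IsPGroup p A) {a : G} (ha : a ∈ A) (hc : ∀ b ∈ hallPart {p}ᶜ F, a * b = b * a) :
    a ∈ F := by
  let C : Subgroup G := A ⊓ Subgroup.centralizer (hallPart {p}ᶜ F : Set G)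
  have hmem : ∀ x, x ∈ C ↔ x ∈ A ∧ ∀ b ∈ hallPart {p}ᶜ F, x * b = b * x := fun x => by
    simp only [C, Subgroup.mem_inf, Subgroup.mem_centralizer_iff, SetLike.mem_coe]
    exact and_congr_right fun _ => forall₂_congr fun _ _ => eq_comm
  have hP : IsPGroup p (hallPart {p} F) := isPiGroup_hallPart.isPGroup
  have hCp : IsPGroup p C := hA.to_le inf_le_left
  have hPC : hallPart {p} F ≤ Subgroup.normalizer (C : Set G) := fun s hs =>
    mem_normalizer_of_conj_mem fun x hx => by
      rw [hmem] at hx ⊢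
      refine ⟨Subgroup.Normal.conj_mem ‹_› x hx.1 s, fun b hb => ?_⟩
      have h1 := commute_hallPart hs hb
      have h2 := commute_hallPart (Subgroup.inv_mem _ hs) hb
      rw [mul_assoc, h2, ← mul_assoc, mul_assoc s, hx.2 b hb, ← mul_assoc, h1]
      group
  refine hF.le_of_isPGroup (hP.to_sup_of_normal_right' hCp hPC) le_sup_left ?_
    (Subgroup.mem_sup_right ((hmem a).2 ⟨ha, hc⟩))
  have hcen : hallPart {p} F ⊔ C ≤ Subgroup.centralizer (hallPart {p}ᶜ F : Set G) :=
    sup_le (fun s hs => Subgroup.mem_centralizer_iff.2 fun b hb => (commute_hallPart hs hb).symm)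
      inf_le_right
  exact fun s hs b hb => (Subgroup.mem_centralizer_iff.1 (hcen hs) b hb).symm

end HallPart

/-- Modulo `A`, the conjugate of `r` lies in the image of `F` and has order prime to `p`, so its
`p`-part is trivial there. -/
theorem exists_conj_hallPart {G : Type*} [Group G] [Finite G] {F A : Subgroup G}
    [A.Normal] [Group.IsNilpotent F] {p : Nat.Primes} {g : G}
    (hg : g ∈ Subgroup.normalizer ((F ⊔ A : Subgroup G) : Set G)) {r : G}
    (hr : r ∈ hallPart {p}ᶜ F) :
    ∃ r' ∈ hallPart {p}ᶜ F, ∃ a ∈ A, g * r * g⁻¹ = r' * a := by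
  obtain ⟨f, hf, a, ha, e⟩ := Subgroup.mem_sup_of_normal_right.1
    ((Subgroup.mem_normalizer_iff.1 hg r).1 (le_sup_left (a := F) (hallPart_le hr)))
  obtain ⟨s, hs, t, ht, rfl⟩ := exists_eq_mul_hallPart (π := {p}) hf
  have hsA : s ∈ A := by
    set n := Nat.card (hallPart {p}ᶜ F) with hn
    have hpow : ∀ x ∈ hallPart {p}ᶜ F, x ^ n = 1 := fun x hx =>
      congrArg Subtype.val (pow_card_eq_one' (x := (⟨x, hx⟩ : hallPart {p}ᶜ F)))
    let π := QuotientGroup.mk' A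
    have ha1 : π a = 1 := (QuotientGroup.eq_one_iff a).2 ha
    have e1 : π g * π r * (π g)⁻¹ = π s * π t := by
      rw [← map_mul, ← map_inv, ← map_mul, ← e, map_mul, ha1, mul_one, map_mul]
    have e2 : π s ^ n = 1 := by
      have hc : Commute (π s) (π t) := by
        change _ * _ = _ * _
        rw [← map_mul, commute_hallPart hs ht, map_mul]
      have := congrArg (· ^ n) e1
      rw [conj_pow, hc.mul_pow, ← map_pow, hpow r hr, ← map_pow π t, hpow t ht, map_one, mul_one,
        mul_one, mul_inv_cancel] at this
      exact this.symm
    have e3 : π s ^ Nat.card (hallPart {p} F) = 1 := by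
      rw [← map_pow]
      have : s ^ Nat.card (hallPart {p} F) = 1 :=
        congrArg Subtype.val (pow_card_eq_one' (x := (⟨s, hs⟩ : hallPart {p} F)))
      rw [this, map_one]
    have hco : (Nat.card (hallPart {p} F)).Coprime n :=
      coprime_card_of_isPiGroup isPiGroup_hallPart isPiGroup_hallPart
    have : π s = 1 := by
      have := Nat.dvd_gcd (orderOf_dvd_of_pow_eq_one e3) (orderOf_dvd_of_pow_eq_one e2)
      rw [hco] at this
      exact orderOf_eq_one_iff.1 (Nat.dvd_one.1 this)
    exact (QuotientGroup.eq_one_iff s).1 this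
  exact ⟨t, ht, s * a, A.mul_mem hsA ha, by rw [← e, commute_hallPart hs ht, mul_assoc]⟩

theorem disjoint_hallPart_compl_of_isPGroup {G : Type*} [Group G] [Finite G] {F A : Subgroup G}
    {p : Nat.Primes} (hA : IsPGroup p A) : Disjoint (hallPart {p}ᶜ F) A := by
  refine Subgroup.disjoint_of_coprime_natCard ?_
  exact (coprime_card_of_isPiGroup (π := {p}) (IsPiGroup.of_isPGroup hA rfl)
    isPiGroup_hallPart).symm

/-- A Frattini-type argument: the `p'`-part `R` of `F` and its conjugate by `g` are complements in
`RA`, so conjugate under `A` by coprime cohomology. After correction by `A`, `g` normalizes `R`,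
hence also the normalizer of `R` in `FA`, which is `F`. -/
theorem IsCarter.normalizer_sup_of_abelian {G : Type*} [Group G] [Finite G] {F A : Subgroup G}
    (hF : IsCarter F) [A.Normal] {p : Nat.Primes} (hA : IsPGroup p A)
    (hab : ∀ a ∈ A, ∀ b ∈ A, a * b = b * a) {g : G}
    (hg : g ∈ Subgroup.normalizer ((F ⊔ A : Subgroup G) : Set G)) : g ∈ F ⊔ A := by
  have hAn : A.Normal := ‹_›
  have := hF.nilpotent
  set R := hallPart {p}ᶜ F with hR
  have hRA : ∀ x ∈ R, x ∈ A → x = 1 := fun x h1 h2 =>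
    Subgroup.disjoint_def.1 (disjoint_hallPart_compl_of_isPGroup hA) h1 h2
  have h1 : ∀ r : R, ∃ c : A, ∃ r' ∈ R, (c : G) * r = g * r' * g⁻¹ := by
    intro r
    obtain ⟨r', hr', a, ha, e⟩ := exists_conj_hallPart (Subgroup.inv_mem _ hg) r.2
    refine ⟨⟨g * (r' * a⁻¹ * r'⁻¹) * g⁻¹,
      hAn.conj_mem _ (hAn.conj_mem _ (A.inv_mem ha) r') g⟩, r', hr', ?_⟩
    have : (r : G) = g * (r' * a) * g⁻¹ := by rw [← e]; group
    rw [this]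
    group
  choose c σ hσ hc using h1
  let _ : CommGroup A := { mul_comm := fun a b => Subtype.ext (hab a a.2 b b.2) }
  let θ : R →* MulAut A := restrictHom (MulAut.conj.comp R.subtype) A fun s a ha =>
    hAn.conj_mem a ha s
  have hθ : ∀ (s : R) (a : A), (θ s a : G) = s * a * (s : G)⁻¹ := fun _ _ => rfl
  -- The defect of multiplicativity of `σ` lies in `R` and in `A`, which meet trivially.
  have hcoc : ∀ s t, c (s * t) = c s * θ s (c t) := by
    intro s t
    have e1 : ((c (s * t) * (c s * θ s (c t))⁻¹ : A) : G)
        = g * (σ (s * t) * (σ s * σ t)⁻¹) * g⁻¹ := by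
      have e2 : ((c s * θ s (c t) : A) : G) = g * (σ s * σ t) * g⁻¹ * (s * t : G)⁻¹ := by
        calc ((c s * θ s (c t) : A) : G) = ((c s : G) * s) * ((c t : G) * t) * (s * t : G)⁻¹ := by
              rw [Subgroup.coe_mul, hθ]; group
          _ = _ := by rw [hc, hc]; group
      have e3 : (c (s * t) : G) = g * σ (s * t) * g⁻¹ * (s * t : G)⁻¹ := by
        rw [← hc, Subgroup.coe_mul, mul_inv_cancel_right]
      rw [Subgroup.coe_mul, Subgroup.coe_inv, e2, e3]
      group
    have hmem : σ (s * t) * (σ s * σ t)⁻¹ ∈ A := by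
      have := hAn.conj_mem _ (c (s * t) * (c s * θ s (c t))⁻¹ : A).2 g⁻¹
      rw [e1] at this
      convert this using 1
      group
    have h1 := hRA _ (R.mul_mem (hσ _) (R.inv_mem (R.mul_mem (hσ s) (hσ t)))) hmem
    rw [h1] at e1
    refine mul_inv_eq_one.1 (Subtype.ext ?_)
    rw [e1]
    simp
  have hcop : (Nat.card R).Coprime (Nat.card A) :=
    (coprime_card_of_isPiGroup (π := {p}) (IsPiGroup.of_isPGroup hA rfl) isPiGroup_hallPart).symm
  have := Fintype.ofFinite R
  obtain ⟨w, hw⟩ := exists_coboundary_of_coprime θ hcop hcoc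
  have hwn : (w : G) ∈ Subgroup.normalizer ((F ⊔ A : Subgroup G) : Set G) :=
    Subgroup.le_normalizer (Subgroup.mem_sup_right w.2)
  set n : G := g⁻¹ * w with hn
  have hnn : n ∈ Subgroup.normalizer ((F ⊔ A : Subgroup G) : Set G) :=
    Subgroup.mul_mem _ (Subgroup.inv_mem _ hg) hwn
  have hnR' : ∀ r ∈ R, n * r * n⁻¹ ∈ R := by
    intro r hr
    have e := hc ⟨r, hr⟩
    rw [hw, Subgroup.coe_mul, Subgroup.coe_inv, hθ] at e
    have : n * r * n⁻¹ = σ ⟨r, hr⟩ := by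
      calc n * r * n⁻¹ = g⁻¹ * (w * (r * w * r⁻¹)⁻¹ * r) * g := by rw [hn]; group
        _ = _ := by rw [e]; group
    rw [this]
    exact hσ _
  have hnR := mem_normalizer_of_conj_mem hnR'
  have hFR : ∀ f ∈ F, f ∈ Subgroup.normalizer (R : Set G) := fun f hf =>
    mem_normalizer_of_conj_mem (hallPart_invariant (ψ := MulAut.conj f) fun x hx =>
      F.mul_mem (F.mul_mem hf hx) (F.inv_mem hf))
  have key : ∀ y ∈ F ⊔ A, y ∈ Subgroup.normalizer (R : Set G) → y ∈ F := by
    intro y hy hyR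
    obtain ⟨f, hf, a, ha, rfl⟩ := Subgroup.mem_sup_of_normal_right.1 hy
    have haR : a ∈ Subgroup.normalizer (R : Set G) := by
      have := Subgroup.mul_mem _ (Subgroup.inv_mem _ (hFR f hf)) hyR
      rwa [inv_mul_cancel_left] at this
    refine F.mul_mem hf (hF.mem_of_commute hA ha fun b hb => ?_)
    have h1 : a * b * a⁻¹ * b⁻¹ = 1 := hRA _
      (R.mul_mem ((Subgroup.mem_normalizer_iff.1 haR b).1 hb) (R.inv_mem hb)) (by
        have := A.mul_mem ha (hAn.conj_mem _ (A.inv_mem ha) b)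
        convert this using 1
        group)
    exact mul_inv_eq_iff_eq_mul.1 (mul_inv_eq_one.1 h1)
  have hnF : n ∈ F := by
    rw [← hF.self_normalizing]
    refine mem_normalizer_of_conj_mem fun f hf => key _ ?_ ?_
    · exact (Subgroup.mem_normalizer_iff.1 hnn f).1 (Subgroup.mem_sup_left hf)
    · exact Subgroup.mul_mem _ (Subgroup.mul_mem _ hnR (hFR f hf)) (Subgroup.inv_mem _ hnR)
  have : g = w * n⁻¹ := by rw [hn]; group
  rw [this]
  exact Subgroup.mul_mem _ (Subgroup.mem_sup_right w.2)
    (Subgroup.inv_mem _ (Subgroup.mem_sup_left hnF))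

theorem isNilpotent_map {G G' : Type*} [Group G] [Group G'] (f : G →* G') {F : Subgroup G}
    (hF : Group.IsNilpotent F) : Group.IsNilpotent (F.map f) :=
  Group.nilpotent_of_surjective (f.subgroupMap F) (f.subgroupMap_surjective F)

theorem isCarter_map_mk {G : Type*} [Group G] {F N : Subgroup G} [N.Normal] (hF : IsCarter F)
    (h : ∀ g ∈ Subgroup.normalizer ((F ⊔ N : Subgroup G) : Set G), g ∈ F ⊔ N) :
    IsCarter (F.map (QuotientGroup.mk' N)) := by
  refine ⟨isNilpotent_map _ hF.nilpotent, le_antisymm ?_ Subgroup.le_normalizer⟩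
  have hs := QuotientGroup.mk'_surjective N
  have hcm : (F.map (QuotientGroup.mk' N)).comap (QuotientGroup.mk' N) = F ⊔ N := by
    rw [Subgroup.comap_map_eq, QuotientGroup.ker_mk']
  intro y hy
  obtain ⟨g, rfl⟩ := hs y
  have : g ∈ F ⊔ N := h g (by
    rw [← hcm, ← Subgroup.comap_normalizer_eq_of_surjective _ hs]
    exact hy)
  rw [← hcm] at this
  exact this

theorem card_quotient_lt {G : Type*} [Group G] [Finite G] {A : Subgroup G} (hA : A ≠ ⊥) :
    Nat.card (G ⧸ A) < Nat.card G := by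
  have : Nontrivial A := (Subgroup.nontrivial_iff_ne_bot A).2 hA
  rw [Subgroup.card_eq_card_quotient_mul_card_subgroup A]
  exact lt_mul_of_one_lt_right Nat.card_pos Finite.one_lt_card

theorem isPGroup_of_pow_eq_one {G : Type*} [Group G] {A : Subgroup G} {p : ℕ}
    (h : ∀ a ∈ A, a ^ p = 1) : IsPGroup p A :=
  isPGroup_iff_pow_pow_eq_one.2 fun a => ⟨1, Subtype.ext (by simpa using h a a.2)⟩

/-- In a finite solvable group, `FN` is self-normalizing if `F` is a Carter subgroup and `N` is
normal. -/
theorem IsCarter.normalizer_sup {G : Type*} [Group G] [Finite G] [Group.IsSolvable G]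
    {F N : Subgroup G} (hF : IsCarter F) [N.Normal] {g : G}
    (hg : g ∈ Subgroup.normalizer ((F ⊔ N : Subgroup G) : Set G)) : g ∈ F ⊔ N := by
  induction hn : Nat.card G using Nat.strong_induction_on generalizing G with | _ n ih
  subst hn
  have hN : N.Normal := ‹_›
  by_cases hbot : N = ⊥
  · subst hbot
    rw [sup_bot_eq] at hg ⊢
    exact hF.self_normalizing.le hg
  obtain ⟨p, hp, A, hAN, hA1, hAp, hab, hinv⟩ := exists_elementary_abelian hbot
  have hAn : A.Normal := ⟨fun a ha g => hinv (MulAut.conj g) (fun x hx => hN.conj_mem x hx g) a ha⟩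
  have hAF : IsCarter (F.map (QuotientGroup.mk' A)) := isCarter_map_mk hF fun g hg =>
    hF.normalizer_sup_of_abelian (p := ⟨p, hp⟩) (isPGroup_of_pow_eq_one hAp) hab hg
  have hs := QuotientGroup.mk'_surjective A
  have hNn : (N.map (QuotientGroup.mk' A)).Normal := hN.map _ hs
  have := ih _ (card_quotient_lt hA1) hAF (N := N.map (QuotientGroup.mk' A))
    (g := QuotientGroup.mk' A g) (by
      rw [← Subgroup.map_sup]
      exact Subgroup.le_normalizer_map _ ⟨g, hg, rfl⟩) rfl
  rw [← Subgroup.map_sup] at this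
  obtain ⟨y, hy, e⟩ := this
  have h1 : y⁻¹ * g ∈ A := QuotientGroup.eq.1 e
  have : g = y * (y⁻¹ * g) := by group
  rw [this]
  exact Subgroup.mul_mem _ hy (Subgroup.mem_sup_right (hAN h1))

theorem IsCarter.subgroupOf {G : Type*} [Group G] [Finite G] {F L : Subgroup G} (hF : IsCarter F)
    (hL : F ≤ L) : IsCarter (F.subgroupOf L) := by
  have := hF.nilpotent
  refine ⟨Group.nilpotent_of_mulEquiv (Subgroup.subgroupOfEquivOfLe hL).symm,
    le_antisymm (fun x hx => ?_) Subgroup.le_normalizer⟩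
  rw [Subgroup.mem_subgroupOf, ← hF.self_normalizing]
  exact mem_normalizer_of_conj_mem fun f hf =>
    (Subgroup.mem_normalizer_iff.1 hx ⟨f, hL hf⟩).1 hf

/-- Inside the normalizer of `K`, the subgroup `K` is normal and `F` is still Carter, so
`IsCarter.normalizer_sup` applies there. -/
theorem IsCarter.mem_sup_of_normalizes {G : Type*} [Group G] [Finite G] [Group.IsSolvable G]
    {F K : Subgroup G} (hF : IsCarter F) (hFK : F ≤ Subgroup.normalizer (K : Set G)) {u : G}
    (huK : u ∈ Subgroup.normalizer (K : Set G))
    (hu : ∀ f ∈ F, u * f * u⁻¹ ∈ F ⊔ K) : u ∈ F ⊔ K := by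
  set L := Subgroup.normalizer (K : Set G) with hL
  have hKL : K ≤ L := Subgroup.le_normalizer
  have hn : (K.subgroupOf L).Normal := Subgroup.normal_in_normalizer
  have hsup : F.subgroupOf L ⊔ K.subgroupOf L = (F ⊔ K).subgroupOf L :=
    (Subgroup.subgroupOf_sup hFK hKL).symm
  have := (hF.subgroupOf hFK).normalizer_sup (N := K.subgroupOf L) (g := ⟨u, huK⟩) (by
    refine mem_normalizer_of_conj_mem fun x hx => ?_
    rw [hsup] at hx ⊢
    obtain ⟨f, hf, k, hk, e⟩ := (Subgroup.mem_sup_of_normal_right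
      (s := F.subgroupOf L) (t := K.subgroupOf L)).1 (hsup ▸ hx)
    have e2 : u * (x : G) * u⁻¹ = (u * (f : G) * u⁻¹) * (u * k * u⁻¹) := by
      rw [← e, Subgroup.coe_mul]; group
    change u * (x : G) * u⁻¹ ∈ F ⊔ K
    rw [e2]
    exact Subgroup.mul_mem _ (hu f hf)
      (Subgroup.mem_sup_right ((Subgroup.mem_normalizer_iff.1 huK k).1 hk)))
  rw [hsup] at this
  exact this

/-! ### Frobenius actions: quotients and lifting of fixed points -/

/-- A group acting by automorphisms, with an invariant Carter subgroup on which its nonidentity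
elements act without nontrivial fixed points. -/
structure FrobeniusCarter {S G : Type*} [Group S] [Group G] (φ : S →* MulAut G)
    (F : Subgroup G) : Prop where
  carter : IsCarter F
  invariant : ∀ s, ∀ x ∈ F, φ s x ∈ F
  fixedPointFree : ∀ s, s ≠ 1 → ∀ x ∈ F, φ s x = x → x = 1

section Twisted

variable {G : Type*} [Group G] {F : Subgroup G} {ψ : MulAut G}

theorem eq_of_inv_mul_apply_eq (hfpf : ∀ f ∈ F, ψ f = f → f = 1) {f g : G} (hf : f ∈ F)
    (hg : g ∈ F) (e : f⁻¹ * ψ f = g⁻¹ * ψ g) : f = g := by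
  have := hfpf (g * f⁻¹) (F.mul_mem hg (F.inv_mem hf)) (by
    rw [map_mul, map_inv, show ψ g = g * (f⁻¹ * ψ f) by rw [e]; group]
    group)
  exact (mul_inv_eq_one.1 this).symm

theorem exists_inv_mul_apply_eq [Finite G] (hF : ∀ f ∈ F, ψ f ∈ F)
    (hfpf : ∀ f ∈ F, ψ f = f → f = 1) {k : G} (hk : k ∈ F) : ∃ f ∈ F, f⁻¹ * ψ f = k := by
  let t : F → F := fun f => ⟨(f : G)⁻¹ * ψ f, F.mul_mem (F.inv_mem f.2) (hF _ f.2)⟩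
  have ht : Function.Injective t := fun f g e =>
    Subtype.ext (eq_of_inv_mul_apply_eq hfpf f.2 g.2 (congrArg Subtype.val e))
  obtain ⟨f, hf⟩ := (Finite.injective_iff_surjective.1 ht) ⟨k, hk⟩
  exact ⟨f, f.2, congrArg Subtype.val hf⟩

/-- The twisted map is onto on `F ⊓ K` and injective on `F`. Hence freeness from fixed points passes
to sections of `F`. -/
theorem mem_of_inv_mul_apply_mem [Finite G] (hF : ∀ f ∈ F, ψ f ∈ F)
    (hfpf : ∀ f ∈ F, ψ f = f → f = 1) {K : Subgroup G} (hK : ∀ k ∈ K, ψ k ∈ K) {f : G}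
    (hf : f ∈ F) (h : f⁻¹ * ψ f ∈ K) : f ∈ K := by
  obtain ⟨y, hy, e⟩ := exists_inv_mul_apply_eq (F := F ⊓ K) (ψ := ψ)
    (fun x hx => ⟨hF x hx.1, hK x hx.2⟩) (fun x hx => hfpf x hx.1)
    (k := f⁻¹ * ψ f) ⟨F.mul_mem (F.inv_mem hf) (hF f hf), h⟩
  exact eq_of_inv_mul_apply_eq hfpf hy.1 hf e ▸ hy.2

end Twisted

section Quotient

variable {S G : Type*} [Group S] [Group G] (φ : S →* MulAut G) (N : Subgroup G) [N.Normal]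
  (hN : ∀ s, ∀ x ∈ N, φ s x ∈ N)

/-- The action induced on the quotient by an invariant normal subgroup. -/
def quotientAction : S →* MulAut (G ⧸ N) where
  toFun s :=
    { toFun := QuotientGroup.map N N (φ s).toMonoidHom (hN s)
      invFun := QuotientGroup.map N N (φ s⁻¹).toMonoidHom (hN s⁻¹)
      left_inv := fun x => by
        induction x using QuotientGroup.induction_on with | H x
        change QuotientGroup.mk (φ s⁻¹ (φ s x)) = _
        simp
      right_inv := fun x => by
        induction x using QuotientGroup.induction_on with | H x
        change QuotientGroup.mk (φ s (φ s⁻¹ x)) = _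
        simp
      map_mul' := map_mul _ }
  map_one' := by
    refine MulEquiv.ext fun x => ?_
    induction x using QuotientGroup.induction_on with | H x
    change QuotientGroup.mk (φ 1 x) = _
    simp
  map_mul' s t := by
    refine MulEquiv.ext fun x => ?_
    induction x using QuotientGroup.induction_on with | H x
    change QuotientGroup.mk (φ (s * t) x) = QuotientGroup.mk (φ s (φ t x))
    simp

theorem quotientAction_mk (s : S) (x : G) :
    quotientAction φ N hN s (QuotientGroup.mk' N x) = QuotientGroup.mk' N (φ s x) := rfl

variable {φ N}

theorem FrobeniusCarter.quotient [Finite G] [Group.IsSolvable G] {F : Subgroup G}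
    (h : FrobeniusCarter φ F) :
    FrobeniusCarter (quotientAction φ N hN) (F.map (QuotientGroup.mk' N)) := by
  refine ⟨isCarter_map_mk h.carter fun g hg => h.carter.normalizer_sup hg, ?_, ?_⟩
  · rintro s _ ⟨x, hx, rfl⟩
    exact ⟨φ s x, h.invariant s x hx, rfl⟩
  · rintro s hs _ ⟨x, hx, rfl⟩ e
    rw [quotientAction_mk] at e
    exact (QuotientGroup.eq_one_iff x).2 (mem_of_inv_mul_apply_mem (h.invariant s)
      (h.fixedPointFree s hs) (hN s) hx (QuotientGroup.eq.1 e.symm))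

end Quotient

/-- The subgroup of elements fixed by an action by automorphisms. -/
def fixedBy {S G : Type*} [Group S] [Group G] (φ : S →* MulAut G) : Subgroup G where
  carrier := {x | ∀ s, φ s x = x}
  one_mem' := fun s => map_one _
  mul_mem' := fun {a b} ha hb s => by rw [map_mul, ha s, hb s]
  inv_mem' := fun {a} ha s => by rw [map_inv, ha s]

theorem bijective_smul_out {S X : Type*} [Group S] [MulAction S X]
    (hfree : ∀ (s : S) (x : X), s • x = x → s = 1) :
    Function.Bijective fun w : S × MulAction.orbitRel.Quotient S X => w.1 • w.2.out := by
  constructor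
  · rintro ⟨s, ω⟩ ⟨s', ω'⟩ e
    simp only at e
    have hmk : ∀ (t : S) (τ : MulAction.orbitRel.Quotient S X),
        (Quotient.mk'' (t • τ.out) : MulAction.orbitRel.Quotient S X) = τ := fun t τ => by
      have h1 : (Quotient.mk'' (t • τ.out) : MulAction.orbitRel.Quotient S X)
          = Quotient.mk'' τ.out := Quotient.sound' ⟨t, rfl⟩
      rw [h1]
      exact Quotient.out_eq' τ
    have h1 : ω = ω' := by rw [← hmk s ω, e, hmk]
    subst h1
    have h2 := hfree (s'⁻¹ * s) ω.out (by rw [mul_smul, e, inv_smul_smul])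
    rw [inv_mul_eq_one.1 h2]
  · intro x
    have : MulAction.orbitRel S X (Quotient.mk'' x : MulAction.orbitRel.Quotient S X).out x :=
      Quotient.exact' (Quotient.out_eq' _)
    obtain ⟨s, hs⟩ := this
    refine ⟨(s⁻¹, Quotient.mk'' x), ?_⟩
    simp only
    rw [← hs, inv_smul_smul]

/-- The nonidentity elements of `F` split into regular `S`-orbits; the product formula turns norms
over `F` into traces over `S`. -/
theorem FrobeniusCarter.exists_orbit_representatives.{u, v} {S : Type v} {G : Type u} [Group S] [Group G]
    [Fintype S] [Finite G] {φ : S →* MulAut G} {F : Subgroup G} [Fintype F]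
    (h : FrobeniusCarter φ F) :
    ∃ (n : ℕ) (r : Fin n → F), (∀ {A : Type u} [CommGroup A] (f : F → A),
      ∏ z, f z = f 1 * ∏ s, ∏ i, f (restrictHom φ F h.invariant s (r i))) ∧
      Nat.card F = 1 + Nat.card S * n := by
  classical
  let X := {z : F // z ≠ 1}
  let θ := restrictHom φ F h.invariant
  let _ : MulAction S X :=
    { smul := fun s z => ⟨θ s z, fun e => z.2 ((map_eq_one_iff _ (θ s).injective).1 e)⟩
      one_smul := fun z => Subtype.ext (by change θ 1 z = z; simp)
      mul_smul := fun s t z => Subtype.ext (by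
        change θ (s * t) z = θ s (θ t z)
        rw [map_mul, MulAut.mul_apply]) }
  have hfree : ∀ (s : S) (x : X), s • x = x → s = 1 := by
    intro s x e
    by_contra hs
    have := h.fixedPointFree s hs x.1 x.1.2 (congrArg (fun y : X => (y.1 : G)) e)
    exact x.2 (Subtype.ext this)
  have hbij := bijective_smul_out hfree
  let Ω := MulAction.orbitRel.Quotient S X
  have : Fintype Ω := Fintype.ofFinite _
  let e : Fin (Fintype.card Ω) ≃ Ω := (Fintype.equivFin Ω).symm
  refine ⟨Fintype.card Ω, fun i => ((e i).out : X).1, fun {A} _ f => ?_, ?_⟩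
  · rw [← Finset.mul_prod_erase _ _ (Finset.mem_univ (1 : F)),
      Finset.prod_subtype (Finset.univ.erase 1) (p := fun z => z ≠ 1) (by simp)]
    congr 1
    rw [← Fintype.prod_prod_type']
    refine (Fintype.prod_bijective (fun w : S × Fin (Fintype.card Ω) => w.1 • ((e w.2).out : X))
      ?_ _ _ fun w => rfl).symm
    exact hbij.comp (Function.bijective_id.prodMap e.bijective)
  · have h1 : Nat.card F = 1 + Nat.card X := by
      rw [Nat.card_eq_fintype_card, Nat.card_eq_fintype_card, Fintype.card_subtype_compl]
      have : 0 < Fintype.card F := Fintype.card_pos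
      simp only [Fintype.card_unique]
      omega
    rw [h1, ← Nat.card_congr (Equiv.ofBijective _ hbij), Nat.card_prod]
    congr 2
    exact Nat.card_eq_fintype_card

/-- The conjugation action of a subgroup on a normal subgroup. -/
abbrev conjHom {G : Type*} [Group G] (R A : Subgroup G) [hA : A.Normal] : R →* MulAut A :=
  restrictHom (MulAut.conj.comp R.subtype) A fun s a ha => hA.conj_mem a ha s

theorem coe_conjHom {G : Type*} [Group G] (R A : Subgroup G) [A.Normal] (r : R) (a : A) :
    (conjHom R A r a : G) = r * a * (r : G)⁻¹ := rfl

/-- The product of the conjugates of an element under a finite subgroup commutes with it. -/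
theorem commute_prod_conj {G A : Type*} [Group G] [Fintype G] [CommGroup A] (κ : G →* MulAut A)
    (a : A) (g : G) : κ g (∏ z, κ z a) = ∏ z, κ z a := by
  rw [map_prod]
  refine Fintype.prod_equiv (Equiv.mulLeft g) _ _ fun z => ?_
  simp

section

variable {S G : Type*} [Group S] [Group G] [Finite S] [Finite G] {φ : S →* MulAut G}
  {F : Subgroup G}

theorem FrobeniusCarter.coprime (h : FrobeniusCarter φ F) :
    (Nat.card S).Coprime (Nat.card F) := by
  have := Fintype.ofFinite S
  have := Fintype.ofFinite F
  obtain ⟨n, r, -, hc⟩ := h.exists_orbit_representatives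
  rw [hc, Nat.coprime_add_mul_left_right]
  exact Nat.coprime_one_right _

/-- The cocycle `s ↦ g⁻¹ * φ s g` becomes, after subtracting a coboundary, its own norm over `F`.
That norm is centralized by `F`, hence lies in `F ⊓ A`, whose order is prime to `|S|`. -/
theorem FrobeniusCarter.exists_mul_mem_fixedBy_of_abelian (h : FrobeniusCarter φ F)
    {A : Subgroup G} [hAn : A.Normal] (hA : ∀ s, ∀ x ∈ A, φ s x ∈ A)
    (hab : ∀ a ∈ A, ∀ b ∈ A, a * b = b * a) {g : G} (hg : ∀ s, g⁻¹ * φ s g ∈ A) :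
    ∃ a ∈ A, g * a ∈ fixedBy φ := by
  have := Fintype.ofFinite S
  have := Fintype.ofFinite F
  let _ : CommGroup A := { mul_comm := fun a b => Subtype.ext (hab a a.2 b b.2) }
  let θ : S →* MulAut A := restrictHom φ A hA
  let κ : F →* MulAut A := conjHom F A
  have hθκ : ∀ s z a, θ s (κ z a) = κ (restrictHom φ F h.invariant s z) (θ s a) := fun s z a =>
    Subtype.ext (by
      change φ s (z * a * (z : G)⁻¹) = φ s z * φ s a * (φ s z)⁻¹
      simp)
  obtain ⟨n, r, hr, -⟩ := h.exists_orbit_representatives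
  -- Chosen so that its `S`-trace is the identity divided by the norm over `F`.
  let e : A →* A :=
    { toFun := fun a => ∏ i, (κ (r i) a)⁻¹
      map_one' := by simp
      map_mul' := fun a b => by
        rw [← Finset.prod_mul_distrib]
        exact Finset.prod_congr rfl fun i _ => by rw [map_mul, mul_inv] }
  have he : ∀ a, ∏ s, θ s (e (θ s⁻¹ a)) = a * (∏ z, κ z a)⁻¹ := by
    intro a
    rw [hr fun z => κ z a]
    simp only [e, MonoidHom.coe_mk, OneHom.coe_mk, map_prod, map_inv, hθκ, MulAut.apply_inv_self,
      Finset.prod_inv_distrib, map_one, MulAut.one_apply, mul_inv_cancel_left, mul_inv]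
  have hB : ∀ a : A, ((∏ z, κ z a : A) : G) ∈ F := by
    intro a
    refine h.carter.self_normalizing.le (mem_normalizer_of_conj_mem fun f hf => ?_)
    have h1 := congrArg Subtype.val (commute_prod_conj κ a ⟨f, hf⟩)
    rw [coe_conjHom] at h1
    have h2 := mul_inv_eq_iff_eq_mul.1 h1
    change f * _ = _ * f at h2
    rw [← h2, mul_inv_cancel_right]
    exact hf
  let c : S → A := fun s => ⟨g⁻¹ * φ s g, hg s⟩
  have hc : ∀ s t, c (s * t) = c s * θ s (c t) := fun s t => Subtype.ext (by
    change g⁻¹ * φ (s * t) g = g⁻¹ * φ s g * φ s (g⁻¹ * φ t g)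
    rw [map_mul φ, MulAut.mul_apply, map_mul, map_inv]
    group)
  obtain ⟨v, hv⟩ := exists_prod_eq_coboundary θ e hc
  have hg1 : ∀ s, (g * v)⁻¹ * φ s (g * v) ∈ F := by
    intro s
    have h1 := hv s
    rw [he] at h1
    have h2 : v⁻¹ * c s * θ s v = ∏ z, κ z (c s) := by
      generalize ∏ z, κ z (c s) = t at h1 ⊢
      rw [mul_inv_eq_iff_eq_mul.1 h1, mul_assoc v, inv_mul_cancel_left, mul_right_comm,
        inv_mul_cancel, one_mul]
    have h3 : (g * v)⁻¹ * φ s (g * v) = ((v⁻¹ * c s * θ s v : A) : G) := by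
      change _ = (v : G)⁻¹ * (g⁻¹ * φ s g) * φ s v
      rw [map_mul]
      group
    rw [h3, h2]
    exact hB _
  have hg1A : ∀ s, (g * v)⁻¹ * φ s (g * v) ∈ A := by
    intro s
    have h3 : (g * v)⁻¹ * φ s (g * v) = ((v⁻¹ * c s * θ s v : A) : G) := by
      change _ = (v : G)⁻¹ * (g⁻¹ * φ s g) * φ s v
      rw [map_mul]
      group
    rw [h3]
    exact Subtype.mem _
  let B : Subgroup G := F ⊓ A
  let _ : CommGroup B := { mul_comm := fun a b => Subtype.ext (hab a a.2.2 b b.2.2) }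
  let θ' : S →* MulAut B := restrictHom φ B fun s x hx => ⟨h.invariant s x hx.1, hA s x hx.2⟩
  let c' : S → B := fun s => ⟨(g * v)⁻¹ * φ s (g * v), hg1 s, hg1A s⟩
  have hc' : ∀ s t, c' (s * t) = c' s * θ' s (c' t) := fun s t => Subtype.ext (by
    change (g * v : G)⁻¹ * φ (s * t) (g * v)
      = (g * v : G)⁻¹ * φ s (g * v) * φ s ((g * v : G)⁻¹ * φ t (g * v))
    rw [map_mul φ, MulAut.mul_apply, map_mul (φ s) (g * v : G)⁻¹, map_inv]
    group)
  obtain ⟨w, hw⟩ := exists_coboundary_of_coprime θ'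
    (h.coprime.coprime_dvd_right (Subgroup.card_dvd_of_le inf_le_left)) hc'
  refine ⟨v * w, A.mul_mem v.2 w.2.2, fun s => ?_⟩
  have h1 : (g * v : G)⁻¹ * φ s (g * v) = w * (φ s w)⁻¹ := congrArg Subtype.val (hw s)
  rw [← mul_assoc, map_mul, ← mul_inv_cancel_left (g * v : G) (φ s (g * v)), h1]
  group

/-- Fixed points in quotients lift to fixed points. -/
theorem FrobeniusCarter.exists_mul_mem_fixedBy [Group.IsSolvable G] (h : FrobeniusCarter φ F)
    {N : Subgroup G} [hNn : N.Normal] (hN : ∀ s, ∀ x ∈ N, φ s x ∈ N) {g : G}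
    (hg : ∀ s, g⁻¹ * φ s g ∈ N) : ∃ n ∈ N, g * n ∈ fixedBy φ := by
  induction hn : Nat.card G using Nat.strong_induction_on generalizing G with | _ n ih
  subst hn
  by_cases hbot : N = ⊥
  · subst hbot
    exact ⟨1, rfl, fun s => by rw [mul_one]; exact (inv_mul_eq_one.1 (hg s)).symm⟩
  obtain ⟨p, hp, A, hAN, hA1, hAp, hab, hinv⟩ := exists_elementary_abelian hbot
  have hAn : A.Normal := ⟨fun a ha g => hinv (MulAut.conj g) (fun x hx => hNn.conj_mem x hx g) a ha⟩
  have hAφ : ∀ s, ∀ x ∈ A, φ s x ∈ A := fun s => hinv (φ s) (hN s)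
  have hs := QuotientGroup.mk'_surjective A
  have hNn' : (N.map (QuotientGroup.mk' A)).Normal := hNn.map _ hs
  obtain ⟨_, ⟨m, hm, rfl⟩, hfix⟩ := ih _ (card_quotient_lt hA1) (h.quotient hAφ)
    (N := N.map (QuotientGroup.mk' A)) (by
      rintro s _ ⟨x, hx, rfl⟩
      exact ⟨φ s x, hN s x hx, rfl⟩) (g := QuotientGroup.mk' A g)
    (fun s => ⟨g⁻¹ * φ s g, hg s, rfl⟩) rfl
  obtain ⟨a, ha, hfix'⟩ := h.exists_mul_mem_fixedBy_of_abelian hAφ hab (g := g * m)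
    fun s => QuotientGroup.eq.1 (hfix s).symm
  exact ⟨m * a, N.mul_mem hm (hAN ha), by rwa [← mul_assoc]⟩

/-! ### Actions without nontrivial fixed points -/

/-- If the action has no nontrivial fixed points, an invariant normal abelian `p`-subgroup lies in
the Carter subgroup. -/
theorem FrobeniusCarter.le_of_fixedBy_eq_bot (h : FrobeniusCarter φ F) (hfix : fixedBy φ = ⊥)
    {A : Subgroup G} [hAn : A.Normal] (hA : ∀ s, ∀ x ∈ A, φ s x ∈ A)
    (hab : ∀ a ∈ A, ∀ b ∈ A, a * b = b * a) {p : Nat.Primes} (hAp : IsPGroup p A) : A ≤ F := by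
  classical
  have := Fintype.ofFinite S
  set R := hallPart {p}ᶜ F with hR
  have := Fintype.ofFinite R
  let _ : CommGroup A := { mul_comm := fun a b => Subtype.ext (hab a a.2 b b.2) }
  let θ : S →* MulAut A := restrictHom φ A hA
  let κ : R →* MulAut A := conjHom R A
  have hRφ : ∀ s, ∀ x ∈ R, φ s x ∈ R := fun s => hallPart_invariant (h.invariant s)
  let τ : S →* MulAut R := restrictHom φ R hRφ
  have hθκ : ∀ s z a, θ s (κ z a) = κ (τ s z) (θ s a) := fun s z a => Subtype.ext (by
    change φ s (z * a * (z : G)⁻¹) = φ s z * φ s a * (φ s z)⁻¹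
    simp)
  have hnorm : ∀ a : A, ∏ s, θ s a = 1 := by
    intro a
    have h1 : ((∏ s, θ s a : A) : G) ∈ fixedBy φ := fun s =>
      congrArg Subtype.val (commute_prod_conj θ a s)
    rw [hfix, Subgroup.mem_bot] at h1
    exact Subtype.ext h1
  -- Norms over `S` and over all its `R`-conjugates are trivial. Multiplied over `R`, the two
  -- families agree in every term with `s ≠ 1`, so the terms at `s = 1` agree as well.
  have key : ∀ a : A, a ^ Nat.card R = ∏ z, κ z a := by
    intro a
    have h1 : ∏ s, ∏ z : R, κ z (θ s (κ z⁻¹ a)) = 1 := by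
      rw [Finset.prod_comm]
      refine Finset.prod_eq_one fun z _ => ?_
      rw [← map_prod, hnorm, map_one]
    -- Moving `θ s` to the right turns `z` into `z * (τ s z)⁻¹`, a permutation of `R` because `s`
    -- has no fixed points there.
    have h2 : ∀ s, s ≠ 1 → ∏ z : R, κ z (θ s (κ z⁻¹ a)) = ∏ z, κ z (θ s a) := by
      intro s hs
      have hinj : Function.Injective fun z : R => z * (τ s z)⁻¹ := by
        intro z w e
        have e' : (z : G) * (φ s z)⁻¹ = w * (φ s w)⁻¹ := congrArg Subtype.val e
        have := eq_of_inv_mul_apply_eq (ψ := φ s) (h.fixedPointFree s hs)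
          (F.inv_mem (hallPart_le z.2)) (F.inv_mem (hallPart_le w.2)) (by simpa using e')
        exact Subtype.ext (inv_injective this)
      refine Fintype.prod_bijective _ (Finite.injective_iff_bijective.1 hinj) _ _ fun z => ?_
      rw [hθκ, ← MulAut.mul_apply, ← map_mul, map_inv (τ s)]
    rw [← Finset.mul_prod_erase _ _ (Finset.mem_univ (1 : S)),
      Finset.prod_congr rfl fun s hs => h2 s (Finset.ne_of_mem_erase hs)] at h1
    have h3 : ∏ s, ∏ z : R, κ z (θ s a) = 1 := by
      rw [Finset.prod_comm]
      exact Finset.prod_eq_one fun z _ => by rw [← map_prod, hnorm, map_one]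
    rw [← Finset.mul_prod_erase _ _ (Finset.mem_univ (1 : S))] at h3
    have h4 := mul_right_cancel (h1.trans h3.symm)
    simpa [Finset.prod_const, Nat.card_eq_fintype_card] using h4
  have hco : (Nat.card A).Coprime (Nat.card R) :=
    coprime_card_of_isPiGroup (π := {p}) (IsPiGroup.of_isPGroup hAp rfl) isPiGroup_hallPart
  intro a ha
  refine h.carter.mem_of_commute hAp ha fun b hb => ?_
  have h1 : (powCoprime hco) (κ ⟨b, hb⟩ ⟨a, ha⟩) = powCoprime hco ⟨a, ha⟩ := by
    simp only [powCoprime_apply]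
    rw [← map_pow, key, commute_prod_conj]
  have h2 := congrArg Subtype.val ((powCoprime hco).injective h1)
  exact (mul_inv_eq_iff_eq_mul.1 h2).symm

/-- If the action has no nontrivial fixed points, the group coincides with its Carter subgroup. -/
theorem FrobeniusCarter.eq_top_of_fixedBy_eq_bot [Group.IsSolvable G] (h : FrobeniusCarter φ F)
    (hfix : fixedBy φ = ⊥) : F = ⊤ := by
  induction hn : Nat.card G using Nat.strong_induction_on generalizing G with | _ n ih
  subst hn
  by_cases hbot : (⊤ : Subgroup G) = ⊥
  · exact le_antisymm le_top (hbot.le.trans bot_le)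
  obtain ⟨p, hp, A, -, hA1, hAp, hab, hinv⟩ := exists_elementary_abelian hbot
  have hAn : A.Normal := ⟨fun a ha g => hinv (MulAut.conj g) (fun _ _ => trivial) a ha⟩
  have hAφ : ∀ s, ∀ x ∈ A, φ s x ∈ A := fun s => hinv (φ s) fun _ _ => trivial
  have hfix' : fixedBy (quotientAction φ A hAφ) = ⊥ := by
    rw [eq_bot_iff]
    intro y hy
    obtain ⟨g, rfl⟩ := QuotientGroup.mk'_surjective A y
    obtain ⟨a, ha, hga⟩ := h.exists_mul_mem_fixedBy hAφ fun s => QuotientGroup.eq.1 (hy s).symm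
    rw [hfix, Subgroup.mem_bot] at hga
    exact (QuotientGroup.eq_one_iff g).2 (by
      rw [mul_eq_one_iff_eq_inv.1 hga]; exact A.inv_mem ha)
  have htop := ih _ (card_quotient_lt hA1) (h.quotient hAφ) hfix' rfl
  have hAF := h.le_of_fixedBy_eq_bot hfix hAφ hab (p := ⟨p, hp⟩) (isPGroup_of_pow_eq_one hAp)
  rw [eq_top_iff]
  intro g _
  obtain ⟨f, hf, e⟩ : QuotientGroup.mk' A g ∈ F.map (QuotientGroup.mk' A) := htop ▸ trivial
  have : g = f * (f⁻¹ * g) := by group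
  rw [this]
  exact F.mul_mem hf (hAF (QuotientGroup.eq.1 e))

end

/-! ### Normal `π`-subgroups of the fixed point subgroup -/

instance {N G : Type*} [Group N] [Group G] [Finite N] [Finite G] (φ : G →* MulAut N) :
    Finite (N ⋊[φ] G) :=
  Finite.of_equiv _ (SemidirectProduct.equivProd (φ := φ)).symm

theorem piCore_invariant {π : Set Nat.Primes} {X : Type*} [Group X] [Finite X] (ψ : MulAut X) {x : X}
    (hx : x ∈ piCore π X) : ψ x ∈ piCore π X :=
  map_piCore_le ψ.toMonoidHom ψ.surjective ⟨x, hx, rfl⟩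

theorem hallPart_normal {G : Type*} [Group G] [Finite G] {D : Subgroup G} [hD : D.Normal]
    (π : Set Nat.Primes) : (hallPart π D).Normal :=
  ⟨fun x hx g => hallPart_invariant (ψ := MulAut.conj g) (fun y hy => hD.conj_mem y hy g) x hx⟩

theorem IsPiGroup.of_map_mk {π : Set Nat.Primes} {G : Type*} [Group G] {N K : Subgroup G}
    [N.Normal] (hN : IsPiGroup π N) (hNK : N ≤ K)
    (hK : IsPiGroup π (K.map (QuotientGroup.mk' N))) : IsPiGroup π K := by
  intro p hp
  have hcard : Nat.card N * Nat.card (K.map (QuotientGroup.mk' N)) = Nat.card K := by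
    rw [← Subgroup.relIndex_bot_left, ← Subgroup.relIndex_bot_left K, ← Subgroup.relIndex_ker,
      QuotientGroup.ker_mk', Subgroup.relIndex_mul_relIndex _ _ _ bot_le hNK]
  rw [← hcard] at hp
  rcases p.2.dvd_mul.1 hp with h | h
  exacts [hN p h, hK p h]

section

variable {S G : Type*} [Group S] [Group G] [Finite G] {φ : S →* MulAut G}
  {F : Subgroup G}

/-- Nonidentity elements of `S` act without nontrivial fixed points on the centralizer of the
Carter subgroup in sections. -/
theorem FrobeniusCarter.mem_of_section [Group.IsSolvable G] (h : FrobeniusCarter φ F)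
    {K : Subgroup G} {s : S} (hs : s ≠ 1) (hFK : F ≤ Subgroup.normalizer (K : Set G))
    (hsK : ∀ k ∈ K, φ s k ∈ K) {u : G} (huK : u ∈ Subgroup.normalizer (K : Set G))
    (huF : ∀ f ∈ F, u⁻¹ * (f⁻¹ * u * f) ∈ K) (hus : u⁻¹ * φ s u ∈ K) : u ∈ K := by
  -- Commuting with `F` modulo `K` makes `u⁻¹` conjugate `F` into `FK`, which is self-normalizing in
  -- the normalizer of `K`.
  have h1 : u⁻¹ ∈ F ⊔ K := by
    refine h.carter.mem_sup_of_normalizes hFK (Subgroup.inv_mem _ huK) fun f hf => ?_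
    have : u⁻¹ * f * u⁻¹⁻¹ = f * (u⁻¹ * (f⁻¹ * u * f))⁻¹ := by group
    rw [this]
    exact Subgroup.mul_mem _ (Subgroup.mem_sup_left hf)
      (Subgroup.mem_sup_right (K.inv_mem (huF f hf)))
  have h2 : u ∈ ((F ⊔ K : Subgroup G) : Set G) := by simpa using Subgroup.inv_mem _ h1
  rw [Subgroup.coe_mul_of_left_le_normalizer_right F K hFK] at h2
  obtain ⟨f, hf, k, hk, rfl⟩ := h2
  refine K.mul_mem (mem_of_inv_mul_apply_mem (h.invariant s) (h.fixedPointFree s hs) hsK hf ?_) hk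
  have := K.mul_mem (K.mul_mem hk hus) (K.inv_mem (hsK k hk))
  convert this using 1
  simp only [map_mul]
  group

/-- If `Q` is a normal `q`-subgroup of the fixed point subgroup contained in a normal subgroup `M`
such that `M / A` is a `q`-group, where `A` is an elementary abelian `p`-group, then `Q`
centralizes `A`. -/
theorem FrobeniusCarter.commute_of_mem [Finite S] [Group.IsSolvable G] (h : FrobeniusCarter φ F)
    {A M Q : Subgroup G} [hAn : A.Normal] (hA : ∀ s, ∀ x ∈ A, φ s x ∈ A)
    (hab : ∀ a ∈ A, ∀ b ∈ A, a * b = b * a) {p q : ℕ} [Fact p.Prime] [Fact q.Prime] (hpq : p ≠ q)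
    (hAp : ∀ a ∈ A, a ^ p = 1) [hMn : M.Normal] (hM : ∀ s, ∀ x ∈ M, φ s x ∈ M)
    (hMq : ∀ m ∈ M, ∃ n, m ^ q ^ n ∈ A) (hQM : Q ≤ M) (hQfix : Q ≤ fixedBy φ)
    (hQn : ∀ c ∈ fixedBy φ, ∀ x ∈ Q, c * x * c⁻¹ ∈ Q) (hQq : IsPGroup q Q) {x a : G} (hx : x ∈ Q)
    (ha : a ∈ A) : x * a = a * x := by
  let Γ := G ⋊[φ] S
  let Θ : Γ →* MulAut G := SemidirectProduct.lift MulAut.conj φ fun s => by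
    ext g y
    simp
  have hΘl : ∀ g y, Θ (SemidirectProduct.inl g) y = g * y * g⁻¹ := fun g y =>
    DFunLike.congr_fun (SemidirectProduct.lift_inl MulAut.conj φ _ g) y
  have hΘr : ∀ s y, Θ (SemidirectProduct.inr s) y = φ s y := fun s y =>
    DFunLike.congr_fun (SemidirectProduct.lift_inr MulAut.conj φ _ s) y
  have hΘA : ∀ γ : Γ, ∀ a ∈ A, Θ γ a ∈ A := fun γ a ha => by
    rw [← SemidirectProduct.inl_left_mul_inr_right γ, map_mul, MulAut.mul_apply, hΘl, hΘr]
    exact hAn.conj_mem _ (hA _ a ha) _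
  let _ : CommGroup A := { mul_comm := fun a b => Subtype.ext (hab a a.2 b b.2) }
  let θ : Γ →* MulAut A := restrictHom Θ A hΘA
  let ι : G →* Γ := SemidirectProduct.inl
  let H : Subgroup Γ := (SemidirectProduct.inr : S →* Γ).range
  have hι : Function.Injective ι := SemidirectProduct.inl_injective
  have haut : ∀ s y, (SemidirectProduct.inr s : Γ) * ι y * (SemidirectProduct.inr s)⁻¹ = ι (φ s y) :=
    fun s y => by rw [← map_inv]; exact (SemidirectProduct.inl_aut s y).symm
  have haut' : ∀ s y, (SemidirectProduct.inr s : Γ)⁻¹ * ι y * SemidirectProduct.inr s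
      = ι (φ s⁻¹ y) := fun s y => by
    have := haut s⁻¹ y
    rwa [map_inv, inv_inv] at this
  have := Fintype.ofFinite H
  have key : θ (ι x) = 1 := by
    refine action_eq_one_of_trivial_on_norm θ (p := p) (q := q) hpq
      (fun a => Subtype.ext (hAp a a.2)) (M := M.map ι) (F := F.map ι) (H := H)
      ?_ ?_ ?_ ?_ ?_ ?_ ⟨x, hQM hx, rfl⟩ ?_ ?_
    · rintro _ ⟨f, hf, rfl⟩
      refine mem_normalizer_of_conj_mem ?_
      rintro _ ⟨m, hm, rfl⟩
      exact ⟨f * m * f⁻¹, hMn.conj_mem m hm f, by simp⟩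
    · rintro _ ⟨s, rfl⟩
      refine mem_normalizer_of_conj_mem ?_
      rintro _ ⟨m, hm, rfl⟩
      exact ⟨φ s m, hM s m hm, (haut s m).symm⟩
    · rintro _ ⟨s, rfl⟩ _ ⟨f, hf, rfl⟩
      exact ⟨φ s f, h.invariant s f hf, (haut s f).symm⟩
    · rintro _ ⟨s, rfl⟩ h1 _ ⟨f, hf, rfl⟩ e
      have hs : s ≠ 1 := fun e => h1 (by rw [e, map_one])
      have := haut s f
      rw [e, mul_inv_cancel_right] at this
      rw [h.fixedPointFree s hs f hf (hι this).symm, map_one]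
    · rintro _ ⟨m, hm, rfl⟩
      obtain ⟨n, hn⟩ := hMq m hm
      refine ⟨n, MulEquiv.ext fun a => Subtype.ext ?_⟩
      change Θ (ι m ^ q ^ n) a = a
      rw [← map_pow, hΘl, hab _ hn a a.2, mul_inv_cancel_right]
    · rintro _ ⟨s, rfl⟩ h1 K hK hKM hKF hKs _ ⟨u, hu, rfl⟩ huF hus
      have hs : s⁻¹ ≠ 1 := fun e => h1 (by rw [inv_eq_one.1 e, map_one])
      have hinv : ∀ g, (∀ a ∈ K, (ι g⁻¹)⁻¹ * a * ι g⁻¹ ∈ K) →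
          g ∈ Subgroup.normalizer ((K.comap ι : Subgroup G) : Set G) := fun g hg =>
        mem_normalizer_of_conj_mem fun k hk => by
          have := hg _ hk
          rw [map_inv, inv_inv] at this
          rw [Subgroup.mem_comap, map_mul, map_mul, map_inv]
          exact this
      have := h.mem_of_section (K := K.comap ι) hs
        (fun f hf => hinv f fun a ha => hKF _ ⟨f⁻¹, F.inv_mem hf, rfl⟩ a ha)
        (fun k hk => by
          rw [Subgroup.mem_comap, ← haut']
          exact hKs _ hk)
        (hinv u fun a ha => hKM _ ⟨u⁻¹, M.inv_mem hu, rfl⟩ a ha)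
        (fun f hf => by
          have := huF _ ⟨f, hf, rfl⟩
          simpa [Subgroup.mem_comap] using this)
        (by
          rw [haut'] at hus
          rw [Subgroup.mem_comap, map_mul, map_inv]
          exact hus)
      exact this
    · rintro _ ⟨s, rfl⟩
      have := haut s x
      rw [hQfix hx s] at this
      exact (mul_inv_eq_iff_eq_mul.1 this).symm
    · intro a
      set N := ∏ h : H, θ h a with hN
      have hNfix : (N : G) ∈ fixedBy φ := fun s => by
        have := commute_prod_conj (θ.comp H.subtype) a ⟨SemidirectProduct.inr s, ⟨s, rfl⟩⟩
        rw [← hΘr]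
        exact congrArg Subtype.val this
      refine Subtype.ext ?_
      change Θ (ι x) N = N
      rw [hΘl, mul_inv_eq_iff_eq_mul]
      -- The norm is a fixed point, so it normalizes `Q`; the commutator then lies in `Q` and in
      -- `A`, of coprime orders.
      have h1 : x * N * x⁻¹ * (N : G)⁻¹ ∈ Q := by
        have := Q.mul_mem hx (hQn N hNfix x⁻¹ (Q.inv_mem hx))
        convert this using 1
        group
      have h2 : x * N * x⁻¹ * (N : G)⁻¹ ∈ A :=
        A.mul_mem (hAn.conj_mem _ N.2 x) (A.inv_mem N.2)
      have hdis := IsPGroup.disjoint_of_ne p q hpq _ _ (isPGroup_of_pow_eq_one hAp) hQq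
      exact mul_inv_eq_iff_eq_mul.1 (mul_inv_eq_one.1 (Subgroup.disjoint_def.1 hdis h2 h1))
  have := congrArg Subtype.val (DFunLike.congr_fun key ⟨a, ha⟩)
  change Θ (ι x) a = a at this
  rw [hΘl] at this
  exact mul_inv_eq_iff_eq_mul.1 this

theorem FrobeniusCarter.le_piCore_singleton [Finite S] [Group.IsSolvable G] (h : FrobeniusCarter φ F)
    (q : Nat.Primes) {Q : Subgroup G} (hQfix : Q ≤ fixedBy φ)
    (hQn : ∀ c ∈ fixedBy φ, ∀ x ∈ Q, c * x * c⁻¹ ∈ Q) (hQq : IsPGroup q Q) :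
    Q ≤ piCore {q} G := by
  induction hn : Nat.card G using Nat.strong_induction_on generalizing G with | _ n ih
  subst hn
  have hq := Fact.mk q.2
  by_cases hbot : (⊤ : Subgroup G) = ⊥
  · exact (le_top.trans hbot.le).trans bot_le
  obtain ⟨p, hp, A, -, hA1, hAp, hab, hinv⟩ := exists_elementary_abelian hbot
  have hpf := Fact.mk hp
  have hAn : A.Normal := ⟨fun a ha g => hinv (MulAut.conj g) (fun _ _ => trivial) a ha⟩
  have hAφ : ∀ s, ∀ x ∈ A, φ s x ∈ A := fun s => hinv (φ s) fun _ _ => trivial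
  let μ := QuotientGroup.mk' A
  have hμ : Function.Surjective μ := QuotientGroup.mk'_surjective A
  have hQ' : Q.map μ ≤ piCore {q} (G ⧸ A) := by
    refine ih _ (card_quotient_lt hA1) (h.quotient hAφ) (Q := Q.map μ) ?_ ?_
      (hQq.map μ) rfl
    · rintro _ ⟨x, hx, rfl⟩ s
      rw [quotientAction_mk, hQfix hx s]
    · rintro y hy _ ⟨x, hx, rfl⟩
      obtain ⟨g, rfl⟩ := hμ y
      obtain ⟨a, ha, hga⟩ := h.exists_mul_mem_fixedBy hAφ fun s => QuotientGroup.eq.1 (hy s).symm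
      have h0 : μ a = 1 := (QuotientGroup.eq_one_iff a).2 ha
      have h1 : μ (g * a) = μ g := by rw [map_mul, h0, mul_one]
      exact ⟨g * a * x * (g * a)⁻¹, hQn _ hga x hx, by rw [← h1]; simp⟩
  let M := (piCore {q} (G ⧸ A)).comap μ
  have hMn : M.Normal := (piCore_normal _ _).comap μ
  have hQM : Q ≤ M := Subgroup.map_le_iff_le_comap.1 hQ'
  have hcore : IsPGroup q (piCore {q} (G ⧸ A)) := (piCore_isPiGroup {q} (G ⧸ A)).isPGroup
  have hAp' := isPGroup_of_pow_eq_one hAp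
  by_cases hpq : p = q
  · subst hpq
    refine hQM.trans (le_piCore hMn (IsPiGroup.of_isPGroup (p := q) ?_ rfl))
    refine hcore.comap_of_ker_isPGroup μ ?_
    rw [QuotientGroup.ker_mk']
    exact hAp'
  -- `D` is a central extension of a `q`-group, so it is nilpotent, and its `q`-core is normal in
  -- `G` and contains `Q`.
  let D : Subgroup G := M ⊓ Subgroup.centralizer (A : Set G)
  have hDn : D.Normal := Subgroup.normal_inf_normal _ _
  have hQD : Q ≤ D := by
    refine le_inf hQM fun x hx => Subgroup.mem_centralizer_iff.2 fun a ha => ?_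
    refine (h.commute_of_mem hAφ hab hpq hAp (M := M) ?_ ?_ hQM hQfix hQn hQq hx ha).symm
    · intro s x hx
      exact piCore_invariant (quotientAction φ A hAφ s) hx
    · intro m hm
      obtain ⟨n, hn⟩ := isPGroup_iff_pow_pow_eq_one.1 hcore ⟨μ m, hm⟩
      refine ⟨n, (QuotientGroup.eq_one_iff _).1 ?_⟩
      exact congrArg Subtype.val hn
  have hDnil : Group.IsNilpotent D := by
    have : Group.IsNilpotent (piCore {q} (G ⧸ A)) := hcore.isNilpotent
    let f : D →* piCore {q} (G ⧸ A) := (μ.comp D.subtype).codRestrict _ fun x => x.2.1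
    refine Subgroup.isNilpotent_of_ker_le_center f fun x hx => ?_
    have hxA : (x : G) ∈ A := (QuotientGroup.eq_one_iff _).1 (congrArg Subtype.val hx)
    exact Subgroup.mem_center_iff.2 fun y => Subtype.ext
      (Subgroup.mem_centralizer_iff.1 y.2.2 x hxA).symm
  have hle : Q ≤ hallPart {q} D := by
    have hQD' : IsPGroup q (Q.subgroupOf D) := hQq.comap_subtype
    obtain ⟨P, hP⟩ := hQD'.exists_le_sylow
    have hPn : (P : Subgroup D).Normal :=
      Sylow.normal_of_normalizerCondition Group.normalizerCondition_of_isNilpotent P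
    exact fun x hx => ⟨⟨x, hQD hx⟩,
      le_piCore (π := {q}) hPn (IsPiGroup.of_isPGroup (p := q) P.2 rfl) (hP hx), rfl⟩
  exact hle.trans (le_piCore (hallPart_normal _) isPiGroup_hallPart)

/-- A normal `π`-subgroup of the fixed point subgroup lies in `O_π(G)`. -/
theorem FrobeniusCarter.map_piCore_fixedBy_le [Finite S] [Group.IsSolvable G] (h : FrobeniusCarter φ F)
    (π : Set Nat.Primes) : (piCore π (fixedBy φ)).map (fixedBy φ).subtype ≤ piCore π G := by
  let N := piCore π G
  have hNn : N.Normal := piCore_normal π G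
  have hNφ : ∀ s, ∀ x ∈ N, φ s x ∈ N := fun s x hx => piCore_invariant (φ s) hx
  let μ := QuotientGroup.mk' N
  have hμ : Function.Surjective μ := QuotientGroup.mk'_surjective N
  -- The preimage of such a core is a normal `π`-subgroup, already contained in `N`.
  have hcore : ∀ q ∈ π, piCore {q} (G ⧸ N) = ⊥ := by
    intro q hq
    have hK : IsPiGroup π ((piCore {q} (G ⧸ N)).comap μ) := by
      refine (piCore_isPiGroup π G).of_map_mk (QuotientGroup.le_comap_mk' N _) ?_
      rw [Subgroup.map_comap_eq_self_of_surjective hμ]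
      exact (piCore_isPiGroup {q} (G ⧸ N)).mono (Set.singleton_subset_iff.2 hq)
    have hle := le_piCore ((piCore_normal _ _).comap μ) hK
    rw [eq_bot_iff]
    intro y hy
    obtain ⟨g, rfl⟩ := hμ y
    exact (QuotientGroup.eq_one_iff g).2 (hle hy)
  let Q := (piCore π (fixedBy φ)).map (fixedBy φ).subtype
  have hQfix : Q ≤ fixedBy φ := Subgroup.map_subtype_le _
  have hQn : ∀ c ∈ fixedBy φ, ∀ x ∈ Q, c * x * c⁻¹ ∈ Q := by
    rintro c hc _ ⟨x, hx, rfl⟩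
    exact ⟨⟨c, hc⟩ * x * ⟨c, hc⟩⁻¹, (piCore_normal π _).conj_mem x hx _, rfl⟩
  have hQπ : IsPiGroup π (Q.map μ) := ((piCore_isPiGroup π _).map _).map μ
  -- Otherwise the image contains a nontrivial elementary abelian `q`-subgroup with `q ∈ π`,
  -- normalized by the fixed points of `G / N` because these lift; the single-prime case puts it in
  -- a trivial core.
  have hbot : Q.map μ = ⊥ := by
    by_contra hne
    obtain ⟨q, hq, A, hAQ, hA1, hAq, -, hinv⟩ := exists_elementary_abelian hne
    have hAq' : IsPGroup q A := isPGroup_of_pow_eq_one hAq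
    have hqf := Fact.mk hq
    have hqπ : (⟨q, hq⟩ : Nat.Primes) ∈ π := by
      refine hQπ ⟨q, hq⟩ (dvd_trans ?_ (Subgroup.card_dvd_of_le hAQ))
      exact hAq'.card_eq_or_dvd.resolve_left fun e => hA1 (Subgroup.card_eq_one.1 e)
    have hle := (h.quotient hNφ).le_piCore_singleton ⟨q, hq⟩ (Q := A) ?_ ?_ hAq'
    · rw [hcore _ hqπ] at hle
      exact hA1 (le_bot_iff.1 hle)
    · intro y hy s
      obtain ⟨x, hx, rfl⟩ := hAQ hy
      rw [quotientAction_mk, hQfix hx s]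
    · intro y hy a ha
      obtain ⟨g, rfl⟩ := hμ y
      obtain ⟨n, hn, hgn⟩ := h.exists_mul_mem_fixedBy hNφ fun s => QuotientGroup.eq.1 (hy s).symm
      have h0 : μ n = 1 := (QuotientGroup.eq_one_iff n).2 hn
      have h1 : μ (g * n) = μ g := by rw [map_mul, h0, mul_one]
      refine hinv (MulAut.conj (μ g)) ?_ a ha
      rintro _ ⟨x, hx, rfl⟩
      refine ⟨g * n * x * (g * n)⁻¹, hQn _ hgn x hx, ?_⟩
      rw [MulAut.conj_apply, ← h1]
      simp
  intro x hx
  have : μ x ∈ Q.map μ := ⟨x, hx, rfl⟩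
  rw [hbot, Subgroup.mem_bot] at this
  exact (QuotientGroup.eq_one_iff x).1 this

end

/-! ### The series and the `π`-length -/

instance piSeries_normal (πs : List (Set Nat.Primes)) (X : Type*) [Group X] :
    (piSeries πs X).Normal :=
  (πs.foldl piStep ⟨(⊥ : Subgroup X), inferInstance⟩).2

theorem piSeries_concat (πs : List (Set Nat.Primes)) (π : Set Nat.Primes) (X : Type*) [Group X] :
    piSeries (πs ++ [π]) X =
      (piCore π (X ⧸ piSeries πs X)).comap (QuotientGroup.mk' (piSeries πs X)) := by
  unfold piSeries
  simp only [List.foldl_append, List.foldl_cons, List.foldl_nil]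
  rfl

theorem piSeries_invariant (πs : List (Set Nat.Primes)) {X : Type*} [Group X] [Finite X]
    (ψ : MulAut X) : ∀ x ∈ piSeries πs X, ψ x ∈ piSeries πs X := by
  induction πs using List.reverseRecOn generalizing ψ with
  | nil =>
    intro x hx
    have : x = 1 := hx
    rw [this, map_one]
    exact Subgroup.one_mem _
  | append_singleton πs π ih =>
    intro x hx
    rw [piSeries_concat] at hx ⊢
    exact piCore_invariant (quotientAction (MonoidHom.id (MulAut X)) _ ih ψ) hx

section

variable {S G : Type*} [Group S] [Group G] [Finite S] [Finite G] [Group.IsSolvable G]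
  {φ : S →* MulAut G} {F : Subgroup G}

theorem FrobeniusCarter.piCore_fixedBy (h : FrobeniusCarter φ F) (π : Set Nat.Primes) :
    piCore π (fixedBy φ) = (piCore π G).subgroupOf (fixedBy φ) :=
  le_antisymm (Subgroup.map_le_iff_le_comap.1 (h.map_piCore_fixedBy_le π))
    (comap_piCore_le _ (fixedBy φ).subtype_injective)

theorem FrobeniusCarter.piSeries_fixedBy (h : FrobeniusCarter φ F) (πs : List (Set Nat.Primes)) :
    piSeries πs (fixedBy φ) = (piSeries πs G).subgroupOf (fixedBy φ) := by
  induction πs using List.reverseRecOn with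
  | nil => exact ((MonoidHom.comap_bot _).trans (Subgroup.ker_subtype _)).symm
  | append_singleton πs π ih =>
    set R := piSeries πs G with hR
    have hRφ : ∀ s, ∀ x ∈ R, φ s x ∈ R := fun s => piSeries_invariant πs (φ s)
    let f : fixedBy φ →* fixedBy (quotientAction φ R hRφ) :=
      ((QuotientGroup.mk' R).comp (fixedBy φ).subtype).codRestrict _ fun x s => by
        change quotientAction φ R hRφ s (QuotientGroup.mk' R x) = QuotientGroup.mk' R x
        rw [quotientAction_mk, x.2 s]
    -- Lifting of fixed points identifies the fixed points of `G / R` with a quotient of those of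
    -- `G`, so the statement on cores can be applied in `G / R`.
    have hf : Function.Surjective f := by
      rintro ⟨y, hy⟩
      obtain ⟨g, rfl⟩ := QuotientGroup.mk'_surjective R y
      obtain ⟨n, hn, hgn⟩ := h.exists_mul_mem_fixedBy hRφ fun s => QuotientGroup.eq.1 (hy s).symm
      refine ⟨⟨g * n, hgn⟩, Subtype.ext ?_⟩
      have h0 : QuotientGroup.mk' R n = 1 := (QuotientGroup.eq_one_iff n).2 hn
      change QuotientGroup.mk' R (g * n) = QuotientGroup.mk' R g
      rw [map_mul, h0, mul_one]
    have hker : piSeries πs (fixedBy φ) = f.ker := by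
      rw [ih]
      ext x
      exact (QuotientGroup.eq_one_iff (x : G)).symm.trans
        ⟨fun e => Subtype.ext e, fun e => congrArg Subtype.val e⟩
    rw [piSeries_concat, piSeries_concat, comap_piCore_quotient f hf _ hker,
      (h.quotient hRφ).piCore_fixedBy π]
    rfl

theorem FrobeniusCarter.isNilpotent_quotient (h : FrobeniusCarter φ F) {R : Subgroup G} [R.Normal]
    (hRφ : ∀ s, ∀ x ∈ R, φ s x ∈ R) (hR : fixedBy φ ≤ R) : Group.IsNilpotent (G ⧸ R) := by
  have hq := h.quotient hRφ
  have htop := hq.eq_top_of_fixedBy_eq_bot (by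
    rw [eq_bot_iff]
    intro y hy
    obtain ⟨g, rfl⟩ := QuotientGroup.mk'_surjective R y
    obtain ⟨n, hn, hgn⟩ := h.exists_mul_mem_fixedBy hRφ fun s => QuotientGroup.eq.1 (hy s).symm
    refine (QuotientGroup.eq_one_iff g).2 ?_
    have := R.mul_mem (hR hgn) (R.inv_mem hn)
    rwa [mul_inv_cancel_right] at this)
  have hnil := hq.carter.nilpotent
  rw [htop] at hnil
  exact Group.isNilpotent_top.1 hnil

end

/-- A nilpotent group is generated by its `π`- and `π'`-cores, so factoring out the first leaves a
`π'`-group. -/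
theorem piSeries_eq_top_of_isNilpotent {X : Type*} [Group X] [Finite X]
    {πs : List (Set Nat.Primes)} (hX : Group.IsNilpotent (X ⧸ piSeries πs X))
    (π : Set Nat.Primes) : piSeries (πs ++ [π] ++ [πᶜ]) X = ⊤ := by
  set R := piSeries πs X with hR
  set R₁ := piSeries (πs ++ [π]) X with hR₁
  have hR₁' : R₁ = (piCore π (X ⧸ R)).comap (QuotientGroup.mk' R) := piSeries_concat πs π X
  have hle : R ≤ R₁ := by rw [hR₁']; exact QuotientGroup.le_comap_mk' R _
  let g : X ⧸ R →* X ⧸ R₁ := QuotientGroup.map R R₁ (MonoidHom.id X) hle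
  have hg : Function.Surjective g := by
    intro y
    obtain ⟨x, rfl⟩ := QuotientGroup.mk'_surjective R₁ y
    exact ⟨QuotientGroup.mk' R x, rfl⟩
  have h1 : (piCore π (X ⧸ R)).map g ≤ piCore πᶜ (X ⧸ R₁) := by
    rintro _ ⟨y, hy, rfl⟩
    obtain ⟨x, rfl⟩ := QuotientGroup.mk'_surjective R y
    have hx : x ∈ R₁ := by rw [hR₁']; exact hy
    have : g (QuotientGroup.mk' R x) = 1 := (QuotientGroup.eq_one_iff x).2 hx
    rw [this]
    exact Subgroup.one_mem _
  have h2 : piCore πᶜ (X ⧸ R₁) = ⊤ := by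
    rw [eq_top_iff, ← Subgroup.map_top_of_surjective g hg, ← piCore_sup_piCore_compl π,
      Subgroup.map_sup]
    exact sup_le h1 (map_piCore_le g hg)
  rw [piSeries_concat, h2, Subgroup.comap_top]

theorem alternating_succ (π : Set Nat.Primes) (m : ℕ) :
    alternating π (m + 1) = alternating π m ++ [π] ++ [πᶜ] := by
  simp [alternating, List.replicate_succ', List.flatten_append]

theorem FrobeniusCarter.piLength_le {S G : Type*} [Group S] [Group G] [Finite S] [Finite G]
    [Group.IsSolvable G] {φ : S →* MulAut G} {F : Subgroup G} (h : FrobeniusCarter φ F)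
    (π : Set Nat.Primes) : piLength π G ≤ piLength π (fixedBy φ) + 1 := by
  classical
  by_cases hex : ∃ m, piSeries (alternating π m) (fixedBy φ) = ⊤
  · have hm := Nat.find_spec hex
    have hmin : ((Nat.find hex : ℕ) : ℕ∞) ≤ piLength π (fixedBy φ) :=
      le_iInf₂ fun m hm => Nat.cast_le.2 (Nat.find_min' hex hm)
    have htop : piSeries (alternating π (Nat.find hex + 1)) G = ⊤ := by
      rw [alternating_succ]
      rw [h.piSeries_fixedBy, Subgroup.subgroupOf_eq_top] at hm
      exact piSeries_eq_top_of_isNilpotent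
        (h.isNilpotent_quotient (fun s => piSeries_invariant _ (φ s)) hm) π
    calc piLength π G ≤ ((Nat.find hex + 1 : ℕ) : ℕ∞) := iInf₂_le (Nat.find hex + 1) htop
      _ = (Nat.find hex : ℕ∞) + 1 := by push_cast; rfl
      _ ≤ _ := by gcongr
  -- If no alternating series reaches the fixed point subgroup, its length is `⊤` and the bound is
  -- vacuous.
  · have : piLength π (fixedBy φ) = ⊤ := by
      unfold piLength
      simp only [iInf_eq_top]
      exact fun m hm => (hex ⟨m, hm⟩).elim
    rw [this, top_add]
    exact le_top

theorem ActsFrobeniusly.frobeniusCarter {G : Type*} [Group G] {H : Subgroup (MulAut G)}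
    {F : Subgroup G} (hCarter : IsCarter F) {hinv : IsInvariant H F}
    (hFrob : ActsFrobeniusly H F hinv) : FrobeniusCarter H.subtype F := by
  refine ⟨hCarter, fun s x hx => hinv s s.2 x hx, fun s hs x hx e => ?_⟩
  by_contra hx1
  refine hFrob.fixed_point_free (SemidirectProduct.inr s) ⟨s, rfl⟩
    (fun e => hs (SemidirectProduct.inr_injective (e.trans (map_one _).symm)))
    (SemidirectProduct.inl ⟨x, hx⟩) ⟨⟨x, hx⟩, rfl⟩
    (fun e => hx1 (congrArg Subtype.val
      (SemidirectProduct.inl_injective (e.trans (map_one _).symm)))) ?_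
  have h1 : restrictAction H F hinv s ⟨x, hx⟩ = ⟨x, hx⟩ := Subtype.ext e
  have h2 := SemidirectProduct.inl_aut (φ := restrictAction H F hinv) s ⟨x, hx⟩
  rw [h1, map_inv] at h2
  exact (eq_mul_inv_iff_mul_eq.1 h2).symm

end FrobCarter

theorem corollary1p2 {G : Type*} [Group G] [Finite G] [Group.IsSolvable G]
    (H : Subgroup (MulAut G)) (F : Subgroup G) (hCarter : FrobCarter.IsCarter F)
    (hinv : FrobCarter.IsInvariant H F) (hFrob : FrobCarter.ActsFrobeniusly H F hinv) :
    (∀ π : Set Nat.Primes,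
      (FrobCarter.piCore π (FrobCarter.fixedSubgroup H)).map (FrobCarter.fixedSubgroup H).subtype =
        FrobCarter.piCore π G ⊓ FrobCarter.fixedSubgroup H) ∧
    (∀ πs : List (Set Nat.Primes),
      (FrobCarter.piSeries πs (FrobCarter.fixedSubgroup H)).map
          (FrobCarter.fixedSubgroup H).subtype =
        FrobCarter.piSeries πs G ⊓ FrobCarter.fixedSubgroup H) ∧
    (∀ π : Set Nat.Primes,
      FrobCarter.piLength π G ≤ FrobCarter.piLength π (FrobCarter.fixedSubgroup H) + 1) := by
  have : Finite (MulAut G) := Finite.of_injective (fun ψ : MulAut G => (ψ : G → G))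
    DFunLike.coe_injective
  have h := hFrob.frobeniusCarter hCarter
  have e : FrobCarter.fixedSubgroup H = FrobCarter.fixedBy H.subtype := rfl
  rw [e]
  refine ⟨fun π => ?_, fun πs => ?_, h.piLength_le⟩
  · rw [h.piCore_fixedBy, Subgroup.subgroupOf_map_subtype]
  · rw [h.piSeries_fixedBy, Subgroup.subgroupOf_map_subtype]
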